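/- **Setting.** A *swap digraph* is a finite nonempty strongly connected digraph $G=(V,A)$ without self-loops or parallel arcs. Vertices are parties; an arc $(u,v)$ is an asset of its seller $u$ to be transferred to its buyer $v$. *HTLC-based protocols.* Time is discrete, $t=0,1,2,\dots$. In each step all parties act simultaneously, and a party $v$ may: create its (only) secret/hashlock pair $(s_v,h_v)$; for arcs $(v,w)$ whose contract does not yet exist, create the hash time-lock contract, giving it a hashlock known to $v$ and a timeout $\tau\in\mathbb N$; claim assets $(u,v)$ whose contract was placed in an earlier step, has timeout at least the current time, and is protected by a hashlock whose secret $v$ knows; send hashlock values that it knows to other parties. A successful claim of $(u,v)$ transfers the asset to $v$ and reveals the secret to $u$; an asset never claimed remains with, or returns to, $u$. A party observes the contracts in which it is seller or buyer (and whether they are claimed) and the hashlocks sent to it; apart from its own secret it knows only the secrets revealed to it by claims. A *protocol* assigns to each party a rule giving its actions at time $t$ from its observations up to time $t$. Parties in a deviating coalition $C\subseteq V$ may act in any feasible way: they share all their secrets, and may use any existing hashlock and also additional hashlocks made up by themselves. They cannot compute the secrets of parties outside $C$ from hashlocks. *Outcomes.* For $D\subseteq V$ let $A^{\rm in}_D$,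 $A^{\rm out}_D$ be the sets of arcs entering and leaving $D$. An outcome of $D$ is a pair $\omega=\langle \omega^{\rm in}\,|\,\omega^{\rm out}\rangle$ with $\omega^{\rm in}\subseteq A^{\rm in}_D$ (assets acquired) and $\omega^{\rm out}\subseteq A^{\rm out}_D$ (assets relinquished). It is *acceptable* if $\omega^{\rm in}=A^{\rm in}_D$ or $\omega^{\rm out}=\emptyset$. Let $\mathrm{Deal}=\langle A^{\rm in}_D|A^{\rm out}_D\rangle$ and $\mathrm{NoDeal}=\langle\emptyset|\emptyset\rangle$. A *preference relation* of $D$ is a partial order $\preceq$ on the outcomes of $D$ such that $\omega_1\preceq\omega_2$ whenever $\omega_1^{\rm in}\subseteq\omega_2^{\rm in}$ and $\omega_1^{\rm out}\supseteq\omega_2^{\rm out}$; $\omega\preceq\mathrm{NoDeal}$ for every unacceptable $\omega$; and $\mathrm{NoDeal}\preceq\mathrm{Deal}$. Given a preference relation for every set of parties, a protocol is *atomic* if it is *live* (if all parties follow it, all assets are transferred), *safe* (every party that follows it ends up in an acceptable outcome, whatever the other parties do), and has the *strong Nash equilibrium property* (no coalition $C$ can, by deviating while all parties outside $C$ follow the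 protocol, obtain an outcome of $C$ strictly preferred to its outcome when all parties follow the protocol). *Reuniclus digraphs.* A *bottleneck digraph* with bottleneck $b$ is a strongly connected digraph in which $b$ belongs to every cycle. $G$ is a *reuniclus digraph* if there are a nonempty set $B\subseteq V$, a rooted tree with node set $B$, and for each $b\in B$ an induced subgraph $G_b$ of $G$ such that: each $G_b$ is a bottleneck digraph with bottleneck $b$; each arc of $G$ lies in some $G_b$; each vertex not in $B$ belongs to exactly one $G_b$; the root $r$ belongs only to $G_r$; and each non-root $b\in B$ belongs exactly to $G_b$ and to $G_{p(b)}$, where $p(b)$ is the parent of $b$, and is an articulation vertex of $G$ (its removal increases the number of connected components of the undirected version of $G$). **Theorem.** Let $G$ be a swap digraph. For any choice of preference relations, $G$ has an atomic HTLC-based protocol if and only if $G$ is a reuniclus digraph. Moreover, $G$ has an HTLC-based protocol that is atomic for all choices of preference relations simultaneously if and only if $G$ is a reuniclus digraph. -/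

import Mathlib

namespace HTLCSwap

noncomputable section

open scoped Classical

universe u

variable {V : Type u}

/-! ### Digraphs -/

/-- There is a directed path from every vertex to every vertex. -/
def StronglyConnected (G : Digraph V) : Prop :=
  ∀ a b : V, Relation.ReflTransGen G.Adj a b

/-- A swap digraph: no self-loops (parallel arcs do not exist in a `Digraph`) and strongly
connected. Vertices are parties; an arc `(a, b)` is an asset of the seller `a` that is to be
transferred to the buyer `b`. -/
structure IsSwapDigraph (G : Digraph V) : Prop where
  loopless : ∀ a, ¬ G.Adj a a
  stronglyConnected : StronglyConnected G

/-- A path: a nonempty sequence of vertices, each (except the last) having an arc to the next one,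
that does not repeat an arc. -/
def IsPath (G : Digraph V) (p : List V) : Prop :=
  p ≠ [] ∧ p.IsChain G.Adj ∧ (p.zip p.tail).Nodup

/-- A cycle: a path with at least one arc whose last vertex equals its first vertex. -/
def IsCycle (G : Digraph V) (c : List V) : Prop :=
  IsPath G c ∧ 2 ≤ c.length ∧ c.head? = c.getLast?

/-- The subgraph of `G` induced by the vertex set `S`. -/
def inducedOn (G : Digraph V) (S : Set V) : Digraph S where
  Adj a b := G.Adj a b

/-- `b` is a bottleneck vertex: it belongs to every cycle. -/
def IsBottleneckVertex (G : Digraph V) (b : V) : Prop :=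
  ∀ c, IsCycle G c → b ∈ c

/-- `G` is a bottleneck digraph with bottleneck `b`. -/
def IsBottleneckDigraph (G : Digraph V) (b : V) : Prop :=
  StronglyConnected G ∧ IsBottleneckVertex G b

/-- Removing `v` from the undirected version of `G` creates a graph with more connected components
than `G` has (used for finite `V`). -/
def IsArticulation (G : Digraph V) (v : V) : Prop :=
  Nat.card G.toSimpleGraphInclusive.ConnectedComponent <
    Nat.card (G.toSimpleGraphInclusive.induce {v}ᶜ).ConnectedComponent

/-- A hierarchical decomposition into induced bottleneck subgraphs. `B` is the set of designated
bottleneck vertices, `comp b` is the vertex set of the component of `b ∈ B`, and `parent`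
(relevant only on `B \ {root}`) makes `B` a tree rooted at `root`. -/
structure IsReuniclusDecomposition (G : Digraph V) (B : Set V) (root : V) (parent : V → V)
    (comp : V → Set V) : Prop where
  root_mem : root ∈ B
  parent_mem : ∀ b ∈ B, b ≠ root → parent b ∈ B
  /-- following parents, one arrives at the root from every node -/
  tree : ∀ b ∈ B, ∃ n : ℕ, parent^[n] b = root
  /-- each induced component is a bottleneck digraph with its designated bottleneck -/
  bottleneck : ∀ b ∈ B, ∃ h : b ∈ comp b, IsBottleneckDigraph (inducedOn G (comp b)) ⟨b, h⟩
  /-- the components make up all of `G`: each arc lies in a component -/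
  arc_mem : ∀ x y, G.Adj x y → ∃ b ∈ B, x ∈ comp b ∧ y ∈ comp b
  /-- a vertex that is not a designated bottleneck lies in exactly one component -/
  mem_ordinary : ∀ x, x ∉ B → ∃! b, b ∈ B ∧ x ∈ comp b
  /-- the root lies in its own component only -/
  mem_root : ∀ c ∈ B, root ∈ comp c ↔ c = root
  /-- any other designated bottleneck lies exactly in its own component and the parent one -/
  mem_nonroot : ∀ b ∈ B, b ≠ root → ∀ c ∈ B, b ∈ comp c ↔ c = b ∨ c = parent b
  /-- bottlenecks of non-root components are articulation vertices -/
  articulation : ∀ b ∈ B, b ≠ root → IsArticulation G b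

/-- Reuniclus digraphs. -/
def IsReuniclus (G : Digraph V) : Prop :=
  ∃ B root parent comp, IsReuniclusDecomposition G B root parent comp

/-! ### HTLC-based protocols

Cryptography is symbolic: a hashlock stands for the corresponding secret/hashlock pair, and
"to know the secret of `h`" is a predicate on states. -/

/-- Hashlock values: `party x` is the hashlock `h_x` of the only secret/hashlock pair that party `x`
may create in a protocol; the values `foreign n` are made up outside the protocol, by deviating
parties only. -/
inductive Hashlock (V : Type u) : Type u
  | party (x : V)
  | foreign (n : ℕ)

/-- The data the seller puts into a hash time-lock contract. -/
structure HTLC (V : Type u) : Type u where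
  lock : Hashlock V
  timeout : ℕ

/-- The actions of one party in one time step. -/
structure Move (V : Type u) : Type u where
  /-- create the own secret/hashlock pair -/
  createPair : Prop
  /-- for each buyer, possibly create the contract that transfers the asset to that buyer -/
  create : V → Option (HTLC V)
  /-- the sellers whose assets are claimed -/
  claim : Set V
  /-- hashlock values sent to each of the other parties -/
  tell : V → Set (Hashlock V)

/-- The state of the world before a time step. -/
structure State (V : Type u) : Type u where
  /-- the parties that have created their secret/hashlock pairs -/
  paired : Set V
  /-- the contract on `(a, b)`, if it has been created (it remains recorded forever) -/
  contract : V → V → Option (HTLC V)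
  /-- the asset `(a, b)` has been successfully claimed by `b` -/
  claimed : V → V → Prop
  /-- the hashlocks that `a` has sent to `b` -/
  told : V → V → Set (Hashlock V)

def State.init : State V where
  paired := ∅
  contract _ _ := none
  claimed _ _ := False
  told _ _ := ∅

/-- `v` itself knows the secret of `h`: it is its own secret, or `v` is the seller of a claimed
contract protected by `h`. -/
def State.KnowsSecret (s : State V) (v : V) (h : Hashlock V) : Prop :=
  (h = .party v ∧ v ∈ s.paired) ∨
    ∃ w c, s.contract v w = some c ∧ c.lock = h ∧ s.claimed v w

/-- `v` itself knows the hashlock `h`: it is its own, or it was read from a contract in which `v`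
is the seller or the buyer, or `v` was told. -/
def State.KnowsLock (s : State V) (v : V) (h : Hashlock V) : Prop :=
  (h = .party v ∧ v ∈ s.paired) ∨
    (∃ w c, (s.contract v w = some c ∨ s.contract w v = some c) ∧ c.lock = h) ∨
    ∃ w, h ∈ s.told w v

/-- `v` can use the secret of `h` in a claim, when `C` is the coalition of deviating parties: its
members share all their secrets and also have the secrets of all foreign hashlocks, while the
parties outside `C` only use what they know themselves. -/
def State.CanOpen (s : State V) (C : Set V) (v : V) (h : Hashlock V) : Prop :=
  s.KnowsSecret v h ∨
    (v ∈ C ∧ ((∃ w ∈ C, s.KnowsSecret w h) ∨ ∃ n, h = .foreign n))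

/-- `v` can use the hashlock `h` for a contract or send it, when `C` is the coalition of deviating
parties. In this step `v` may create the pair that it uses. Members of `C` may use every existing
hashlock and all foreign ones. -/
def State.CanUseLock (s : State V) (C : Set V) (m : Move V) (v : V) (h : Hashlock V) : Prop :=
  (h = .party v ∧ m.createPair) ∨ s.KnowsLock v h ∨
    (v ∈ C ∧ ((∃ x ∈ s.paired, h = .party x) ∨ ∃ n, h = .foreign n))

/-- Simultaneous execution of the moves `mv` of all parties in time step `t`; actions that are not
possible have no effect. A contract can be created only on an arc and only once; an asset can be
claimed if its contract is already placed, the current time does not exceed the timeout, and the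
buyer can provide the secret. -/
def State.step (G : Digraph V) (C : Set V) (t : ℕ) (s : State V) (mv : V → Move V) : State V where
  paired := s.paired ∪ {v | (mv v).createPair}
  contract a b :=
    match s.contract a b with
    | some c => some c
    | none =>
      if G.Adj a b then
        ((mv a).create b).filter fun c => decide (s.CanUseLock C (mv a) a c.lock)
      else none
  claimed a b :=
    s.claimed a b ∨
      (a ∈ (mv b).claim ∧
        ∃ c, s.contract a b = some c ∧ t ≤ c.timeout ∧ s.CanOpen C b c.lock)
  told a b := s.told a b ∪ {h | h ∈ (mv a).tell b ∧ s.CanUseLock C (mv a) a h}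

/-- What a single party observes of a state: whether its own pair exists, the contracts in which it
is the buyer or the seller and whether they were claimed, and the hashlocks it was sent. -/
structure View (V : Type u) : Type u where
  paired : Prop
  incoming : V → Option (HTLC V)
  outgoing : V → Option (HTLC V)
  claimedIn : V → Prop
  claimedOut : V → Prop
  heard : V → Set (Hashlock V)

def State.view (s : State V) (v : V) : View V where
  paired := v ∈ s.paired
  incoming a := s.contract a v
  outgoing b := s.contract v b
  claimedIn a := s.claimed a v
  claimedOut b := s.claimed v b
  heard a := s.told a v

/-- An HTLC-based protocol: for each party a rule that gives its move in time step `t` as a function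
of what it observed at times `t, t-1, …, 0` (a list of length `t + 1`, latest first). There is no
other interaction between the parties, and no restriction on local computation. -/
structure Protocol (V : Type u) : Type u where
  move : V → List (View V) → Move V

/-- A state together with the observations so far of all parties (latest first). -/
structure Config (V : Type u) : Type u where
  state : State V
  hist : V → List (View V)

/-- The execution in which the members of `C` deviate and make the moves `adv` (time, party), and all
other parties follow `P`; `run G P C adv t` is the configuration before time step `t`. As rules are
deterministic and `adv` is arbitrary, adaptive behavior of the members of `C` is included. -/
def run (G : Digraph V) (P : Protocol V) (C : Set V) (adv : ℕ → V → Move V) : ℕ → Config V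
  | 0 => ⟨State.init, fun v => [State.init.view v]⟩
  | t + 1 =>
    let k := run G P C adv t
    let s := k.state.step G C t fun v => if v ∈ C then adv t v else P.move v (k.hist v)
    ⟨s, fun v => s.view v :: k.hist v⟩

/-- The asset `(a, b)` ends up with `b`; otherwise it remains with, or is returned to, `a`. -/
def Transferred (G : Digraph V) (P : Protocol V) (C : Set V) (adv : ℕ → V → Move V) (a b : V) :
    Prop :=
  ∃ t, (run G P C adv t).state.claimed a b

/-! ### Outcomes, preferences and atomicity -/

/-- Arcs from outside `D` into `D`. -/
def inArcs (G : Digraph V) (D : Set V) : Set (V × V) :=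
  {e | G.Adj e.1 e.2 ∧ e.1 ∉ D ∧ e.2 ∈ D}

/-- Arcs from `D` to outside of `D`. -/
def outArcs (G : Digraph V) (D : Set V) : Set (V × V) :=
  {e | G.Adj e.1 e.2 ∧ e.1 ∈ D ∧ e.2 ∉ D}

/-- An outcome of a set `D` of parties (of a single party `v` if `D = {v}`). -/
@[ext]
structure Outcome (G : Digraph V) (D : Set V) : Type u where
  acquired : Set (V × V)
  relinquished : Set (V × V)
  acquired_subset : acquired ⊆ inArcs G D
  relinquished_subset : relinquished ⊆ outArcs G D

/-- All incoming assets are acquired, or no outgoing asset is relinquished. The other outcomes are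
the "underwater" ones. -/
def Outcome.Acceptable {G : Digraph V} {D : Set V} (o : Outcome G D) : Prop :=
  o.acquired = inArcs G D ∨ o.relinquished = ∅

def Outcome.deal (G : Digraph V) (D : Set V) : Outcome G D :=
  ⟨inArcs G D, outArcs G D, subset_rfl, subset_rfl⟩

def Outcome.noDeal (G : Digraph V) (D : Set V) : Outcome G D :=
  ⟨∅, ∅, Set.empty_subset _, Set.empty_subset _⟩

/-- A preference relation of `D`: a partial order on the outcomes of `D`, where `le o₁ o₂` means that
`o₂` is at least as good as `o₁`, with the three standard properties. -/
structure Preference (G : Digraph V) (D : Set V) : Type u where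
  le : Outcome G D → Outcome G D → Prop
  refl : ∀ o, le o o
  trans : ∀ o₁ o₂ o₃, le o₁ o₂ → le o₂ o₃ → le o₁ o₃
  antisymm : ∀ o₁ o₂, le o₁ o₂ → le o₂ o₁ → o₁ = o₂
  /-- receiving more and relinquishing less is better -/
  mono : ∀ o₁ o₂ : Outcome G D, o₁.acquired ⊆ o₂.acquired → o₂.relinquished ⊆ o₁.relinquished →
    le o₁ o₂
  /-- `noDeal` is better than every underwater outcome -/
  underwater_le : ∀ o : Outcome G D, ¬ o.Acceptable → le o (Outcome.noDeal G D)
  /-- `deal` is better than `noDeal` (unless they coincide, which happens only if no arc joins `D`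
  and its complement) -/
  noDeal_le_deal : le (Outcome.noDeal G D) (Outcome.deal G D)

/-- Strict preference: `o₂` is better than `o₁`. -/
def Preference.lt {G : Digraph V} {D : Set V} (p : Preference G D) (o₁ o₂ : Outcome G D) : Prop :=
  p.le o₁ o₂ ∧ o₁ ≠ o₂

/-- The outcome of `D` in an execution. -/
def outcome (G : Digraph V) (P : Protocol V) (C : Set V) (adv : ℕ → V → Move V) (D : Set V) :
    Outcome G D where
  acquired := {e | e ∈ inArcs G D ∧ Transferred G P C adv e.1 e.2}
  relinquished := {e | e ∈ outArcs G D ∧ Transferred G P C adv e.1 e.2}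
  acquired_subset _ h := h.1
  relinquished_subset _ h := h.1

/-- If all parties follow the protocol (so that `adv` is irrelevant), all assets are transferred. -/
def Live (G : Digraph V) (P : Protocol V) : Prop :=
  ∀ adv a b, G.Adj a b → Transferred G P ∅ adv a b

/-- Each party that follows the protocol ends up in an acceptable outcome, whatever the other
parties do. -/
def Safe (G : Digraph V) (P : Protocol V) : Prop :=
  ∀ C adv, ∀ v ∉ C, (outcome G P C adv {v}).Acceptable

/-- No coalition `C` can, by deviating while all others follow the protocol, achieve an outcome of
`C` better than the one it has when all parties follow the protocol. -/
def StrongNash (G : Digraph V) (pref : ∀ D : Set V, Preference G D) (P : Protocol V) : Prop :=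
  ∀ C adv adv₀, ¬ (pref C).lt (outcome G P ∅ adv₀ C) (outcome G P C adv C)

/-- Atomic: live, safe, and strong Nash equilibrium. -/
structure IsAtomic (G : Digraph V) (pref : ∀ D : Set V, Preference G D) (P : Protocol V) : Prop where
  live : Live G P
  safe : Safe G P
  strongNash : StrongNash G pref P

end

end HTLCSwap

/-!
For both equivalences it suffices that a live and safe protocol exists if and only if the digraph is
reuniclus: liveness and safety imply the strong Nash property for all preference relations
(`strongNash_of_live_of_safe`), since the compliant parties pass on losses and shortfalls along paths
until they reach the coalition.

*Sufficiency.* In a reuniclus digraph, label each arc by the bottleneck of its component, whose hashlock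
is to protect the contract. An arc is foreign if its label is not its seller. If a party sells a
foreign arc, all its incoming arcs carry its own label or that of the foreign arc. Moreover, foreign
arcs form no closed walk, because along them one stays in a component, away from its bottleneck, or
passes on to the parent component (`IsReuniclusDecomposition.exists_isScheme`). So parties can create
foreign contracts after their incoming contracts, with deadlines that decrease along foreign arcs,
and claim all their incoming assets in a single step once they know the secrets. A party that loses an
asset thereby learns the only secret it lacks, or has already claimed everything
(`safe_schemeProtocol`, `live_schemeProtocol`).

*Necessity.* Consider the execution of a live and safe protocol in which nobody deviates. For a party
`v`, all others may imitate this execution up to some time, then stop, and claim a single asset of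
`v`; by safety, all incoming contracts of `v` must already be in place and be opened by the
secret of `v` and the one just revealed (`incoming_of_safe`). It follows that all contracts precede the
first claim, and that the labels of the contracts (the owners of their hashlocks) satisfy the
same local conditions as above (`exists_isLabelling`). The arcs with a given label then form a
strongly connected subgraph through that label, all cycles in it pass through the label, and each party
other than the maker of the first claim sees exactly one label besides its own, which yields the tree
(`IsLabelling.isReuniclus`).
-/

namespace HTLCSwap

open scoped Classical

universe u

variable {V : Type u}

/-! ### Preference relations and the Nash property -/

/-- If some arc leaves `D`, a path leading back to its tail has to enter `D` again. -/
theorem outArcs_eq_empty_of_inArcs_eq_empty {G : Digraph V} (hG : StronglyConnected G) {D : Set V}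
    (h : inArcs G D = ∅) : outArcs G D = ∅ := by
  by_contra hne
  obtain ⟨⟨c, d⟩, -, hc, hd⟩ := Set.nonempty_iff_ne_empty.2 hne
  have key : ∀ x, Relation.ReflTransGen G.Adj d x → x ∉ D := by
    intro x hx
    induction hx with
    | refl => exact hd
    | @tail y z _ hyz ih =>
      intro hz
      have : (y, z) ∈ inArcs G D := ⟨hyz, ih, hz⟩
      simp [h] at this
  exact key c (hG d c) hc

theorem Outcome.Acceptable.mono {G : Digraph V} {D : Set V} {o₁ o₂ : Outcome G D}
    (h : o₁.Acceptable) (ha : o₁.acquired ⊆ o₂.acquired) (hr : o₂.relinquished ⊆ o₁.relinquished) :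
    o₂.Acceptable := by
  rcases h with h | h
  · exact .inl (o₂.acquired_subset.antisymm (h ▸ ha))
  · exact .inr (Set.subset_empty_iff.1 (h ▸ hr))

theorem Outcome.eq_noDeal {G : Digraph V} (hG : StronglyConnected G) {D : Set V} {o : Outcome G D}
    (h : o.Acceptable) (ha : o.acquired = ∅) : o = Outcome.noDeal G D := by
  have hr : o.relinquished = ∅ := by
    rcases h with h | h
    · exact Set.subset_empty_iff.1
        (o.relinquished_subset.trans (outArcs_eq_empty_of_inArcs_eq_empty hG (h ▸ ha)).subset)
    · exact h
  ext1
  · exact ha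
  · exact hr

/-- The least preference relation of `D`: the order generated by the three required properties.
Beyond the comparisons by inclusion, it only puts the underwater outcomes and `noDeal` below all
acceptable ones. -/
def minimalPreference {G : Digraph V} (hG : StronglyConnected G) (D : Set V) : Preference G D where
  le o₁ o₂ := (o₁.acquired ⊆ o₂.acquired ∧ o₂.relinquished ⊆ o₁.relinquished) ∨
    ((¬ o₁.Acceptable ∨ o₁ = Outcome.noDeal G D) ∧ o₂.Acceptable)
  refl o := .inl ⟨subset_rfl, subset_rfl⟩
  trans := by
    rintro o₁ o₂ o₃ (⟨h1, h2⟩ | ⟨h1, h2⟩) (⟨h3, h4⟩ | ⟨h3, h4⟩)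
    · exact .inl ⟨h1.trans h3, h4.trans h2⟩
    · refine .inr ⟨?_, h4⟩
      by_cases hA : o₁.Acceptable
      · obtain rfl := h3.resolve_left (not_not_intro (hA.mono h1 h2))
        exact .inr (Outcome.eq_noDeal hG hA (Set.subset_empty_iff.1 h1))
      · exact .inl hA
    · exact .inr ⟨h1, h2.mono h3 h4⟩
    · exact .inr ⟨h1, h4⟩
  antisymm := by
    have key : ∀ o₁ o₂ : Outcome G D, o₁.acquired ⊆ o₂.acquired →
        o₂.relinquished ⊆ o₁.relinquished → (¬ o₂.Acceptable ∨ o₂ = Outcome.noDeal G D) →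
        o₁.Acceptable → o₁ = o₂ := by
      intro o₁ o₂ h1 h2 h3 h4
      obtain rfl := h3.resolve_left (not_not_intro (h4.mono h1 h2))
      exact Outcome.eq_noDeal hG h4 (Set.subset_empty_iff.1 h1)
    rintro o₁ o₂ (⟨h1, h2⟩ | ⟨h1, h2⟩) (⟨h3, h4⟩ | ⟨h3, h4⟩)
    · ext1
      · exact h1.antisymm h3
      · exact h4.antisymm h2
    · exact key o₁ o₂ h1 h2 h3 h4
    · exact (key o₂ o₁ h3 h4 h1 h2).symm
    · rw [h1.resolve_left (not_not_intro h4), h3.resolve_left (not_not_intro h2)]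
  mono o₁ o₂ h1 h2 := .inl ⟨h1, h2⟩
  underwater_le o h := .inr ⟨.inl h, .inr rfl⟩
  noDeal_le_deal := .inr ⟨.inr rfl, .inl rfl⟩

theorem mem_acquired_singleton {G : Digraph V} (hG : IsSwapDigraph G) {P : Protocol V} {C : Set V}
    {adv : ℕ → V → Move V} {v : V} :
    (outcome G P C adv {v}).acquired = inArcs G {v} ↔
      ∀ u, G.Adj u v → Transferred G P C adv u v := by
  constructor
  · intro h u hu
    have : (u, v) ∈ inArcs G {v} := ⟨hu, fun e : u = v => hG.loopless v (e ▸ hu), rfl⟩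
    rw [← h] at this
    exact this.2
  · intro h
    refine (outcome G P C adv {v}).acquired_subset.antisymm ?_
    rintro ⟨u, w⟩ ⟨h1, h2, rfl : w = v⟩
    exact ⟨⟨h1, h2, rfl⟩, h u h1⟩

theorem relinquished_singleton_eq_empty {G : Digraph V} (hG : IsSwapDigraph G) {P : Protocol V}
    {C : Set V} {adv : ℕ → V → Move V} {v : V} :
    (outcome G P C adv {v}).relinquished = ∅ ↔
      ∀ w, G.Adj v w → ¬ Transferred G P C adv v w := by
  rw [Set.eq_empty_iff_forall_notMem]
  constructor
  · intro h w hw ht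
    exact h (v, w) ⟨⟨hw, rfl, fun e : w = v => hG.loopless v (e ▸ hw)⟩, ht⟩
  · rintro h ⟨a, w⟩ ⟨⟨h1, rfl : a = v, -⟩, h2⟩
    exact h w h1 h2

/-- A single party ends up in an acceptable outcome if and only if it gets all its incoming assets
as soon as it loses an outgoing one. -/
theorem acceptable_singleton_iff {G : Digraph V} (hG : IsSwapDigraph G) {P : Protocol V}
    {C : Set V} {adv : ℕ → V → Move V} {v : V} :
    (outcome G P C adv {v}).Acceptable ↔
      ∀ w, G.Adj v w → Transferred G P C adv v w →
        ∀ u, G.Adj u v → Transferred G P C adv u v := by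
  rw [Outcome.Acceptable, mem_acquired_singleton hG, relinquished_singleton_eq_empty hG]
  constructor
  · rintro (h | h) w hw ht u hu
    · exact h u hu
    · exact (h w hw ht).elim
  · intro h
    by_cases h' : ∀ w, G.Adj v w → ¬ Transferred G P C adv v w
    · exact .inr h'
    · push Not at h'
      obtain ⟨w, hw, ht⟩ := h'
      exact .inl (h w hw ht)

/-- Liveness and safety imply the strong Nash property. The compliant parties pass on both a
lost asset (backwards) and a missing asset (forwards) until the coalition is reached; hence a
coalition that gains something loses something, and one that gains everything loses everything. -/
theorem strongNash_of_live_of_safe {G : Digraph V} (hG : IsSwapDigraph G) {P : Protocol V}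
    (hl : Live G P) (hs : Safe G P) (pref : ∀ D : Set V, Preference G D) :
    StrongNash G pref P := by
  intro C adv adv₀ hlt
  have hdeal : outcome G P ∅ adv₀ C = Outcome.deal G C := by
    ext e
    · exact ⟨fun h => h.1, fun h => ⟨h, hl adv₀ _ _ h.1⟩⟩
    · exact ⟨fun h => h.1, fun h => ⟨h, hl adv₀ _ _ h.1⟩⟩
  rw [hdeal] at hlt
  obtain ⟨hle, hne⟩ := hlt
  have hsafe := fun v hv => (acceptable_singleton_iff hG).1 (hs C adv v hv)
  have hbad : ¬ (pref C).le (outcome G P C adv C) (Outcome.noDeal G C) := fun h =>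
    hne ((pref C).antisymm _ _ hle ((pref C).trans _ _ _ h (pref C).noDeal_le_deal))
  by_cases hacc : (outcome G P C adv C).Acceptable
  · rcases hacc with hin | hout
    · -- a missing outgoing arc of the coalition would entail a missing incoming one
      refine hne (Outcome.ext hin.symm (Set.Subset.antisymm ?_ fun e h => h.1))
      rintro ⟨c, d⟩ ⟨hcd, hc, hd⟩
      refine ⟨⟨hcd, hc, hd⟩, ?_⟩
      by_contra hnt
      have key : ∀ x, Relation.ReflTransGen G.Adj d x →
          x ∉ C ∧ ∃ y, G.Adj y x ∧ ¬ Transferred G P C adv y x := by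
        intro x hx
        induction hx with
        | refl => exact ⟨hd, c, hcd, hnt⟩
        | @tail y z _ hyz ih =>
          obtain ⟨hy, x, hxy, hx⟩ := ih
          have hyzt : ¬ Transferred G P C adv y z := fun ht => hx (hsafe y hy z hyz ht x hxy)
          refine ⟨fun hz => hyzt ?_, y, hyz, hyzt⟩
          have : (y, z) ∈ inArcs G C := ⟨hyz, hy, hz⟩
          rw [← hin] at this
          exact this.2
      exact (key c (hG.stronglyConnected d c)).1 hc
    · refine hbad ((pref C).mono _ _ ?_ (Set.empty_subset _))
      -- an acquired asset would entail a relinquished one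
      rintro ⟨d, c⟩ ⟨⟨hdc, hd, hc⟩, ht⟩
      exfalso
      have key : ∀ x, Relation.ReflTransGen G.Adj x d →
          x ∉ C ∧ ∃ y, G.Adj x y ∧ Transferred G P C adv x y := by
        intro x hx
        induction hx using Relation.ReflTransGen.head_induction_on with
        | refl => exact ⟨hd, c, hdc, ht⟩
        | @head z y hzy _ ih =>
          obtain ⟨hy, x, hyx, hx⟩ := ih
          have hzyt := hsafe y hy x hyx hx z hzy
          refine ⟨fun hz => ?_, y, hzy, hzyt⟩
          have : (z, y) ∈ (outcome G P C adv C).relinquished := ⟨⟨hzy, hz, hy⟩, hzyt⟩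
          simp [hout] at this
      exact (key c (hG.stronglyConnected c d)).1 hc
  · exact hbad ((pref C).underwater_le _ hacc)

/-! ### Executions -/

theorem State.step_contract_eq_some_iff {G : Digraph V} {C : Set V} {t : ℕ} {s : State V}
    {mv : V → Move V} {a b : V} {c : HTLC V} :
    (s.step G C t mv).contract a b = some c ↔ s.contract a b = some c ∨
      (s.contract a b = none ∧ G.Adj a b ∧ (mv a).create b = some c ∧
        s.CanUseLock C (mv a) a c.lock) := by
  simp only [State.step]
  cases h : s.contract a b with
  | some c' => simp
  | none => by_cases hadj : G.Adj a b <;> simp [hadj, Option.filter_eq_some_iff]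

/-- The moves made in time step `t` of an execution. -/
noncomputable def moves (G : Digraph V) (P : Protocol V) (C : Set V) (adv : ℕ → V → Move V)
    (t : ℕ) (v : V) : Move V :=
  if v ∈ C then adv t v else P.move v ((run G P C adv t).hist v)

section Run

variable {G : Digraph V} {P : Protocol V} {C : Set V} {adv : ℕ → V → Move V} {t t' : ℕ} {a b v : V}
  {c : HTLC V}

theorem run_succ_state : (run G P C adv (t + 1)).state =
    (run G P C adv t).state.step G C t (moves G P C adv t) := rfl

theorem run_succ_hist : (run G P C adv (t + 1)).hist v =
    (run G P C adv (t + 1)).state.view v :: (run G P C adv t).hist v := rfl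

theorem run_hist_eq : ∃ l, (run G P C adv t).hist v = (run G P C adv t).state.view v :: l ∧
    l.length = t := by
  induction t with
  | zero => exact ⟨[], rfl, rfl⟩
  | succ t ih =>
    obtain ⟨l, h1, h2⟩ := ih
    exact ⟨_, run_succ_hist, by rw [h1, List.length_cons, h2]⟩

theorem contract_mono (h : t ≤ t') (hc : (run G P C adv t).state.contract a b = some c) :
    (run G P C adv t').state.contract a b = some c := by
  induction t', h using Nat.le_induction with
  | base => exact hc
  | succ n _ ih => exact State.step_contract_eq_some_iff.2 (.inl ih)

theorem claimed_mono (h : t ≤ t') (hc : (run G P C adv t).state.claimed a b) :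
    (run G P C adv t').state.claimed a b := by
  induction t', h using Nat.le_induction with
  | base => exact hc
  | succ n _ ih => exact .inl ih

theorem paired_mono (h : t ≤ t') (hc : v ∈ (run G P C adv t).state.paired) :
    v ∈ (run G P C adv t').state.paired := by
  induction t', h using Nat.le_induction with
  | base => exact hc
  | succ n _ ih => exact .inl ih

theorem contract_eq_of_eq {c' : HTLC V} (h : (run G P C adv t).state.contract a b = some c)
    (h' : (run G P C adv t').state.contract a b = some c') : c = c' := by
  have h1 := contract_mono (le_max_left t t') h
  rw [contract_mono (le_max_right t t') h'] at h1
  exact (Option.some.inj h1).symm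

theorem exists_contract_of_claimed (h : (run G P C adv t).state.claimed a b) :
    ∃ c, (run G P C adv t).state.contract a b = some c := by
  induction t with
  | zero => exact h.elim
  | succ t ih =>
    have : ∃ c, (run G P C adv t).state.contract a b = some c := by
      rcases h with h | ⟨-, c, hc, -⟩
      · exact ih h
      · exact ⟨c, hc⟩
    obtain ⟨c, hc⟩ := this
    exact ⟨c, contract_mono t.le_succ hc⟩

/-- A created contract has a creation step. -/
theorem exists_create (h : (run G P C adv t).state.contract a b = some c) :
    ∃ k < t, (run G P C adv k).state.contract a b = none ∧
      (run G P C adv (k + 1)).state.contract a b = some c := by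
  induction t with
  | zero => cases h
  | succ t ih =>
    rcases hc : (run G P C adv t).state.contract a b with _ | c'
    · exact ⟨t, t.lt_succ_self, hc, h⟩
    · obtain rfl := contract_eq_of_eq h hc
      obtain ⟨k, hk, h⟩ := ih hc
      exact ⟨k, hk.trans t.lt_succ_self, h⟩

theorem adj_of_contract (h : (run G P C adv t).state.contract a b = some c) : G.Adj a b := by
  obtain ⟨k, -, h1, h2⟩ := exists_create h
  rcases State.step_contract_eq_some_iff.1 h2 with h2 | ⟨-, h2, -⟩
  · rw [h1] at h2
    cases h2
  · exact h2

/-- A claimed asset has a claim step. -/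
theorem exists_claim (h : (run G P C adv t).state.claimed a b) :
    ∃ k < t, ¬ (run G P C adv k).state.claimed a b ∧
      (run G P C adv (k + 1)).state.claimed a b := by
  induction t with
  | zero => exact h.elim
  | succ t ih =>
    by_cases hc : (run G P C adv t).state.claimed a b
    · obtain ⟨k, hk, h⟩ := ih hc
      exact ⟨k, hk.trans t.lt_succ_self, h⟩
    · exact ⟨t, t.lt_succ_self, hc, h⟩

end Run

/-! ### The protocol of a labelled digraph -/

/-- The combinatorial content of an atomic protocol. The contract on the arc `(a, b)` is to be
protected by the hashlock of `lab a b`; an arc is called *foreign* if this is not the hashlock of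
its seller `a`. A larger rank `m v` means that `v` creates its foreign contracts later and claims its
incoming assets earlier. -/
structure IsScheme (G : Digraph V) (lab : V → V → V) (m : V → ℕ) : Prop where
  rank_lt : ∀ a b, G.Adj a b → lab a b ≠ a → m a < m b
  incoming : ∀ a b c, G.Adj a b → G.Adj b c → lab b c ≠ b → lab a b = b ∨ lab a b = lab b c
  exists_prev : ∀ a b, G.Adj a b → lab a b ≠ a → ∃ c, G.Adj c a ∧ lab c a = lab a b
  exists_next : ∀ a b, G.Adj a b → lab a b ≠ b → ∃ c, G.Adj b c ∧ lab b c = lab a b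

section Scheme

variable (G : Digraph V) (lab : V → V → V) (dl : V → ℕ)

/-- The contract that the protocol prescribes on the arc `(a, b)`. The timeout `dl b` depends on the
buyer only. -/
def expected (a b : V) : HTLC V := ⟨.party (lab a b), dl b⟩

/-- According to the observation `o` made at time `t`, the party `v` is able to claim all its incoming
assets at once. -/
def Ready (v : V) (t : ℕ) (o : View V) : Prop :=
  o.paired ∧ t ≤ dl v ∧ ∀ a, G.Adj a v → o.incoming a = some (expected lab dl a v) ∧
    (lab a v = v ∨ ∃ b c, o.outgoing b = some c ∧ c.lock = .party (lab a v) ∧ o.claimedOut b)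

/-- The rule for `v` at time `t` with observation `o`: contracts with the own hashlock are created
immediately, foreign ones as soon as all incoming contracts are in place as expected, and the
incoming assets are claimed only if this is possible for all of them in the same time step. -/
noncomputable def schemeMove (v : V) (t : ℕ) (o : View V) : Move V where
  createPair := True
  create b := if lab v b = v ∨ ∀ a, G.Adj a v → o.incoming a = some (expected lab dl a v)
    then some (expected lab dl v b) else none
  claim := {_a | Ready G lab dl v t o}
  tell _ := ∅

/-- The protocol of a labelled digraph with deadlines `dl`. It needs only the latest observation and
the time, which is the number of the earlier observations. -/
noncomputable def schemeProtocol : Protocol V where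
  move v
    | [] => ⟨False, fun _ => none, ∅, fun _ => ∅⟩
    | o :: l => schemeMove G lab dl v l.length o

variable {G lab dl} {C : Set V} {adv : ℕ → V → Move V} {t : ℕ} {v w : V}

theorem moves_schemeProtocol (hv : v ∉ C) :
    moves G (schemeProtocol G lab dl) C adv t v =
      schemeMove G lab dl v t ((run G (schemeProtocol G lab dl) C adv t).state.view v) := by
  obtain ⟨l, h1, h2⟩ := run_hist_eq (G := G) (P := schemeProtocol G lab dl) (C := C) (adv := adv)
    (t := t) (v := v)
  rw [moves, if_neg hv, h1, ← h2]
  rfl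

theorem paired_schemeProtocol (hv : v ∉ C) :
    v ∈ (run G (schemeProtocol G lab dl) C adv (t + 1)).state.paired := by
  rw [run_succ_state]
  right
  simp [moves_schemeProtocol hv, schemeMove]

theorem claimed_of_ready (hv : v ∉ C)
    (h : Ready G lab dl v t ((run G (schemeProtocol G lab dl) C adv t).state.view v)) {a : V}
    (ha : G.Adj a v) : (run G (schemeProtocol G lab dl) C adv (t + 1)).state.claimed a v := by
  rw [run_succ_state]
  right
  obtain ⟨h1, h2, h3⟩ := id h
  obtain ⟨h4, h5⟩ := h3 a ha
  refine ⟨by rw [moves_schemeProtocol hv]; exact h, _, h4, h2, .inl ?_⟩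
  rcases h5 with h5 | ⟨b, c, h5, h6, h7⟩
  · exact .inl ⟨congrArg _ h5, h1⟩
  · exact .inr ⟨b, c, h5, h6, h7⟩

theorem contract_schemeProtocol (hv : v ∉ C) {c : HTLC V}
    (h : (run G (schemeProtocol G lab dl) C adv t).state.contract v w = some c) :
    c = expected lab dl v w ∧ (lab v w = v ∨ ∀ a, G.Adj a v →
      (run G (schemeProtocol G lab dl) C adv t).state.contract a v =
        some (expected lab dl a v)) := by
  obtain ⟨k, hk, h1, h2⟩ := exists_create h
  rcases State.step_contract_eq_some_iff.1 h2 with h2 | ⟨-, -, h2, -⟩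
  · rw [h1] at h2
    cases h2
  · change (moves G (schemeProtocol G lab dl) C adv k v).create w = some c at h2
    rw [moves_schemeProtocol hv] at h2
    by_cases hc : lab v w = v ∨ ∀ a, G.Adj a v →
        ((run G (schemeProtocol G lab dl) C adv k).state.view v).incoming a =
          some (expected lab dl a v)
    · simp only [schemeMove, if_pos hc, Option.some.injEq] at h2
      exact ⟨h2.symm, hc.imp_right fun hc a ha => contract_mono hk.le (hc a ha)⟩
    · simp [schemeMove, if_neg hc] at h2

/-- A compliant party reveals its own secret only by claiming all its incoming assets. -/
theorem claimed_of_own_secret_revealed (hv : v ∉ C) {a b : V} {c : HTLC V}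
    (hc : (run G (schemeProtocol G lab dl) C adv t).state.contract a b = some c)
    (hlock : c.lock = .party v)
    (hcl : (run G (schemeProtocol G lab dl) C adv t).state.claimed a b) {x : V} (hx : G.Adj x v) :
    (run G (schemeProtocol G lab dl) C adv t).state.claimed x v := by
  induction t generalizing a b c with
  | zero => exact hcl.elim
  | succ t ih =>
    have ih' : (∃ a b c, (run G (schemeProtocol G lab dl) C adv t).state.contract a b = some c ∧
        c.lock = .party v ∧ (run G (schemeProtocol G lab dl) C adv t).state.claimed a b) →
        (run G (schemeProtocol G lab dl) C adv (t + 1)).state.claimed x v := by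
      rintro ⟨a, b, c, h1, h2, h3⟩
      exact claimed_mono t.le_succ (ih h1 h2 h3)
    rcases hcl with hcl | ⟨hm, c', hc', -, hopen⟩
    · obtain ⟨c', hc'⟩ := exists_contract_of_claimed hcl
      obtain rfl := contract_eq_of_eq hc hc'
      exact ih' ⟨a, b, c, hc', hlock, hcl⟩
    · obtain rfl := contract_eq_of_eq hc hc'
      rw [hlock] at hopen
      rcases hopen with (⟨hb, -⟩ | ⟨y, d, h1, h2, h3⟩) |
        ⟨-, ⟨y, hy, ⟨h1, -⟩ | ⟨z, d, h1, h2, h3⟩⟩ | ⟨n, h1⟩⟩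
      · obtain rfl : v = b := by simpa using hb
        change a ∈ (moves G (schemeProtocol G lab dl) C adv t v).claim at hm
        rw [moves_schemeProtocol hv] at hm
        exact claimed_of_ready hv hm hx
      · exact ih' ⟨b, y, d, h1, h2, h3⟩
      · obtain rfl : v = y := by simpa using h1
        exact (hv hy).elim
      · exact ih' ⟨y, z, d, h1, h2, h3⟩
      · cases h1

end Scheme

theorem safe_schemeProtocol {G : Digraph V} (hG : IsSwapDigraph G) {lab : V → V → V} {dl : V → ℕ}
    (hdl : ∀ a b, G.Adj a b → lab a b ≠ a → dl b < dl a)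
    (hin : ∀ a b c, G.Adj a b → G.Adj b c → lab b c ≠ b → lab a b = b ∨ lab a b = lab b c) :
    Safe G (schemeProtocol G lab dl) := by
  intro C adv v hv
  rw [acceptable_singleton_iff hG]
  rintro w hvw ⟨t, ht⟩ a ha
  obtain ⟨k, -, hk, hk'⟩ := exists_claim ht
  obtain ⟨-, c, hc, hkc, -⟩ := hk'.resolve_left hk
  have hc1 := contract_mono k.le_succ hc
  obtain ⟨rfl, hcase⟩ := contract_schemeProtocol hv hc1
  by_cases hlab : lab v w = v
  · exact ⟨k + 1, claimed_of_own_secret_revealed hv hc1 (congrArg _ hlab) hk' ha⟩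
  · -- the claim reveals the secret at time `k + 1`, just before the deadlines of `v`
    refine ⟨k + 1 + 1, claimed_of_ready hv ⟨paired_schemeProtocol hv,
      Nat.succ_le_of_lt (lt_of_le_of_lt hkc (hdl v w hvw hlab)), fun b hb =>
        ⟨hcase.resolve_left hlab b hb, ?_⟩⟩ ha⟩
    exact (hin b v w hb hvw hlab).imp_right fun h => ⟨w, _, hc1, congrArg _ h.symm, hk'⟩

/-- If all parties are compliant, `v` has created its contracts by time `m v + 2`, and claims at its
deadline at the latest. By `exists_next`, the secrets that it needs are revealed by buyers with
earlier deadlines. -/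
theorem live_schemeProtocol {G : Digraph V} {lab : V → V → V} {m : V → ℕ}
    (h : IsScheme G lab m) {N : ℕ} (hN : ∀ v, m v ≤ N) :
    Live G (schemeProtocol G lab fun v => N + 2 + (N - m v)) := by
  intro adv
  set dl : V → ℕ := fun v => N + 2 + (N - m v) with hdl
  have hmem : ∀ v : V, v ∉ (∅ : Set V) := fun v => Set.notMem_empty v
  have create : ∀ n v, m v = n → ∀ w, G.Adj v w →
      (run G (schemeProtocol G lab dl) ∅ adv (n + 2)).state.contract v w =
        some (expected lab dl v w) := by
    intro n
    induction n using Nat.strong_induction_on with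
    | _ n ih =>
    rintro v rfl w hvw
    have key : (run G (schemeProtocol G lab dl) ∅ adv (m v + 2)).state.contract v w ≠ none := by
      intro hnone
      have hstep : ∀ k ≤ m v + 1, (lab v w = v ∨ ∀ a, G.Adj a v →
          (run G (schemeProtocol G lab dl) ∅ adv k).state.contract a v =
            some (expected lab dl a v)) →
          (run G (schemeProtocol G lab dl) ∅ adv k).state.CanUseLock ∅
            (moves G (schemeProtocol G lab dl) ∅ adv k v) v (.party (lab v w)) → False := by
        intro k hk hcond hlock
        have hk0 : (run G (schemeProtocol G lab dl) ∅ adv k).state.contract v w = none := by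
          rcases hc : (run G (schemeProtocol G lab dl) ∅ adv k).state.contract v w with _ | c
          · rfl
          · rw [contract_mono (hk.trans (Nat.le_succ _)) hc] at hnone
            cases hnone
        have : (run G (schemeProtocol G lab dl) ∅ adv (k + 1)).state.contract v w =
            some (expected lab dl v w) := by
          refine State.step_contract_eq_some_iff.2 (.inr ⟨hk0, hvw, ?_, hlock⟩)
          change (moves G (schemeProtocol G lab dl) ∅ adv k v).create w = _
          rw [moves_schemeProtocol (hmem v)]
          exact if_pos hcond
        rw [contract_mono (Nat.succ_le_succ hk) this] at hnone
        cases hnone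
      by_cases hlab : lab v w = v
      · refine hstep 0 (Nat.zero_le _) (.inl hlab) (.inl ⟨congrArg _ hlab, ?_⟩)
        rw [moves_schemeProtocol (hmem v)]
        trivial
      · have hprev : ∀ a, G.Adj a v →
            (run G (schemeProtocol G lab dl) ∅ adv (m v + 1)).state.contract a v =
              some (expected lab dl a v) := by
          intro a ha
          by_cases hla : lab a v = a
          · -- contracts with the hashlock of the seller are created in the first step
            refine contract_mono (Nat.succ_le_succ (Nat.zero_le (m v))) ?_
            refine State.step_contract_eq_some_iff.2 (.inr ⟨rfl, ha, ?_, .inl ⟨?_, ?_⟩⟩)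
            · change (moves G (schemeProtocol G lab dl) ∅ adv 0 a).create v = _
              rw [moves_schemeProtocol (hmem a)]
              exact if_pos (.inl hla)
            · exact congrArg _ hla
            · change (moves G (schemeProtocol G lab dl) ∅ adv 0 a).createPair
              rw [moves_schemeProtocol (hmem a)]
              trivial
          · have hlt := h.rank_lt a v ha hla
            exact contract_mono (by omega) (ih (m a) hlt a rfl v ha)
        obtain ⟨a, ha, hla⟩ := h.exists_prev v w hvw hlab
        exact hstep _ le_rfl (.inr hprev)
          (.inr (.inl (.inr (.inl ⟨a, _, .inr (hprev a ha), congrArg _ hla⟩))))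
    obtain ⟨c, hc⟩ := Option.ne_none_iff_exists'.1 key
    rw [hc, (contract_schemeProtocol (hmem v) hc).1]
  have create' : ∀ t, N + 2 ≤ t → ∀ v w, G.Adj v w →
      (run G (schemeProtocol G lab dl) ∅ adv t).state.contract v w =
        some (expected lab dl v w) := fun t ht v w hvw =>
    contract_mono (by have := hN v; omega) (create (m v) v rfl w hvw)
  have claim : ∀ n v, N - m v = n → ∀ u, G.Adj u v →
      (run G (schemeProtocol G lab dl) ∅ adv (dl v + 1)).state.claimed u v := by
    intro n
    induction n using Nat.strong_induction_on with
    | _ n ih =>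
    rintro v rfl u hu
    have hle : N + 2 ≤ dl v := Nat.le_add_right _ _
    refine claimed_of_ready (hmem v) ⟨?_, le_rfl, fun a ha => ⟨create' _ hle a v ha, ?_⟩⟩ hu
    · exact paired_mono (by omega : N + 1 + 1 ≤ dl v) (paired_schemeProtocol (hmem v))
    · by_cases hla : lab a v = v
      · exact .inl hla
      · obtain ⟨w, hvw, hw⟩ := h.exists_next a v ha hla
        have hlt := h.rank_lt v w hvw (hw ▸ hla)
        have := hN w
        refine .inr ⟨w, _, create' _ hle v w hvw, congrArg _ hw, ?_⟩
        exact claimed_mono (by simp only [hdl]; omega) (ih (N - m w) (by omega) w rfl v hvw)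
  exact fun a b hab => ⟨_, claim _ b rfl a hab⟩

/-! ### Cycles and ranks -/

/-- A closed walk contains a cycle. -/
theorem exists_isCycle_of_transGen {W : Type*} {H : Digraph W} {R : W → W → Prop}
    (hR : ∀ x y, R x y → H.Adj x y) {x : W} (h : Relation.TransGen R x x) :
    ∃ l, IsCycle H l ∧ l.IsChain R := by
  have hex : ∃ n, ∃ l : List W, l.length = n ∧ l.IsChain R ∧ 2 ≤ l.length ∧
      l.head? = l.getLast? := by
    obtain ⟨y, hxy, hyx⟩ := Relation.TransGen.head'_iff.1 h
    obtain ⟨l, hl, hlast⟩ := List.exists_isChain_cons_of_relationReflTransGen hyx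
    refine ⟨_, x :: y :: l, rfl, ?_, by simp, ?_⟩
    · exact List.isChain_cons_cons.2 ⟨hxy, hl⟩
    · rw [List.head?_cons, List.getLast?_eq_getLast_of_ne_nil (List.cons_ne_nil _ _),
        List.getLast_cons (List.cons_ne_nil _ _), hlast]
  obtain ⟨l, hlen, hl, h2, hends⟩ := Nat.find_spec hex
  refine ⟨l, ⟨⟨by rintro rfl; simp at h2, hl.imp hR, ?_⟩, h2, hends⟩, hl⟩
  -- in a closed walk of minimal length, no vertex and hence no arc is repeated
  rw [List.nodup_iff_getElem?_ne_getElem?]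
  intro i j hij hj heq
  have hj' : j + 1 < l.length := by simp at hj; omega
  rw [List.getElem?_eq_getElem (hij.trans hj), List.getElem?_eq_getElem hj] at heq
  have hv : l[i] = l[j] := by simpa using congrArg (Option.map Prod.fst) heq
  refine Nat.find_min hex (m := j - i + 1) (by omega)
    ⟨(l.drop i).take (j - i + 1), by simp; omega, (hl.drop i).take _, by simp; omega, ?_⟩
  rw [List.head?_eq_getElem?, List.getLast?_eq_getElem?]
  have : min (j - i + 1) (l.length - i) - 1 = j - i := by omega
  simp only [this, List.getElem?_take, List.getElem?_drop, Nat.zero_lt_succ, if_true, add_zero,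
    Nat.lt_succ_self, show i + (j - i) = j by omega, List.length_take, List.length_drop]
  rw [List.getElem?_eq_getElem (by omega), List.getElem?_eq_getElem (by omega), hv]

theorem forall_mem_of_isChain {W : Type*} {R : W → W → Prop} {p : W → Prop}
    (hR : ∀ x y, R x y → p x ∧ p y) {l : List W} (hl : l.IsChain R) (h2 : 2 ≤ l.length) :
    ∀ x ∈ l, p x := by
  match l, hl, h2 with
  | x :: y :: l, hl, _ =>
    obtain ⟨hxy, hl⟩ := List.isChain_cons_cons.1 hl
    have hp := hR x y hxy
    have : ∀ z ∈ y :: l, p z :=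
      hl.induction (p := p) _ (fun a b hab _ => (hR a b hab).2) (fun _ => hp.2)
    intro z hz
    rcases List.mem_cons.1 hz with rfl | hz
    · exact hp.1
    · exact this z hz

/-- An acyclic relation on a finite type has a rank function. -/
theorem exists_rank [Finite V] {F : V → V → Prop} (hF : ∀ v, ¬ Relation.TransGen F v v) :
    ∃ m : V → ℕ, ∀ v w, F v w → m v < m w := by
  refine ⟨fun v => {u | Relation.TransGen F u v}.ncard, fun v w hvw => ?_⟩
  refine Set.ncard_lt_ncard ⟨fun u hu => hu.tail hvw, fun hsub => ?_⟩ (Set.toFinite _)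
  exact hF v (hsub (Relation.TransGen.single hvw))

/-! ### From a reuniclus decomposition to a protocol -/

namespace IsReuniclusDecomposition

variable {G : Digraph V} {B : Set V} {r : V} {parent : V → V} {comp : V → Set V}

/-- The depth in the tree `B`. -/
theorem exists_depth (D : IsReuniclusDecomposition G B r parent comp) :
    ∃ d : V → ℕ, ∀ b ∈ B, b ≠ r → d (parent b) < d b := by
  refine ⟨fun b => if h : ∃ n, parent^[n] b = r then Nat.find h else 0, fun b hb hbr => ?_⟩
  have h1 := D.tree b hb
  have h2 := D.tree _ (D.parent_mem b hb hbr)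
  simp only [dif_pos h1, dif_pos h2]
  rcases hn : Nat.find h1 with _ | n
  · have := Nat.find_spec h1
    rw [hn] at this
    exact (hbr this).elim
  · refine Nat.lt_succ_of_le (Nat.find_min' h2 ?_)
    have := Nat.find_spec h1
    rwa [hn] at this

theorem comp_unique (D : IsReuniclusDecomposition G B r parent comp) {v b c : V} (hb : b ∈ B)
    (hc : c ∈ B) (hvb : v ∈ comp b) (hvc : v ∈ comp c) (hbv : b ≠ v) (hcv : c ≠ v) : b = c := by
  by_cases hv : v ∈ B
  · by_cases hr : v = r
    · subst hr
      exact (hbv ((D.mem_root b hb).1 hvb)).elim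
    · rw [((D.mem_nonroot v hv hr b hb).1 hvb).resolve_left hbv,
        ((D.mem_nonroot v hv hr c hc).1 hvc).resolve_left hcv]
  · exact (D.mem_ordinary v hv).unique ⟨hb, hvb⟩ ⟨hc, hvc⟩

theorem exists_upper (D : IsReuniclusDecomposition G B r parent comp) {v : V} (hv : v ≠ r) :
    ∃ b ∈ B, b ≠ v ∧ v ∈ comp b := by
  by_cases hB : v ∈ B
  · obtain ⟨d, hd⟩ := D.exists_depth
    exact ⟨parent v, D.parent_mem v hB hv, fun h => (hd v hB hv).ne (congrArg d h),
      (D.mem_nonroot v hB hv _ (D.parent_mem v hB hv)).2 (.inr rfl)⟩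
  · obtain ⟨b, ⟨h1, h2⟩, -⟩ := D.mem_ordinary v hB
    exact ⟨b, h1, fun h => hB (h ▸ h1), h2⟩

/-- Two components have at most one vertex in common. -/
theorem comp_unique_of_ne (D : IsReuniclusDecomposition G B r parent comp) {x y b c : V}
    (hxy : x ≠ y) (hb : b ∈ B) (hc : c ∈ B) (hxb : x ∈ comp b) (hyb : y ∈ comp b)
    (hxc : x ∈ comp c) (hyc : y ∈ comp c) : b = c := by
  by_contra hbc
  obtain ⟨d, hd⟩ := D.exists_depth
  have key : ∀ x y, x ≠ y → x ∈ B → y ∈ B → x ∈ comp y → d y < d x := by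
    intro x y hxy hx hy h
    have hxr : x ≠ r := by
      rintro rfl
      exact hxy ((D.mem_root y hy).1 h).symm
    rw [((D.mem_nonroot x hx hxr y hy).1 h).resolve_left hxy.symm]
    exact hd x hx hxr
  have h1 : b = x ∨ c = x := by
    by_contra! h
    exact hbc (D.comp_unique hb hc hxb hxc h.1 h.2)
  have h2 : b = y ∨ c = y := by
    by_contra! h
    exact hbc (D.comp_unique hb hc hyb hyc h.1 h.2)
  rcases h1 with rfl | rfl <;> rcases h2 with rfl | rfl
  · exact hxy rfl
  · exact lt_asymm (key b c hxy hb hc hxc) (key c b hxy.symm hc hb hyb)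
  · exact lt_asymm (key b c hxy.symm hb hc hyc) (key c b hxy hc hb hxb)
  · exact hxy rfl

/-- The arcs of a component that avoid its bottleneck form no closed walk. -/
theorem acyclic_comp (D : IsReuniclusDecomposition G B r parent comp) {b : V} (hb : b ∈ B)
    (x : comp b) :
    ¬ Relation.TransGen (fun y z : comp b => G.Adj y z ∧ (y : V) ≠ b ∧ (z : V) ≠ b) x x := by
  intro h
  obtain ⟨hmem, hbot⟩ := D.bottleneck b hb
  obtain ⟨l, hl, hch⟩ := exists_isCycle_of_transGen (H := inducedOn G (comp b))
    (fun y z h => h.1) h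
  exact forall_mem_of_isChain (p := fun y : comp b => (y : V) ≠ b) (fun y z h => h.2) hch hl.2.1 _
    (hbot.2 l hl) rfl

/-- Along foreign arcs, the component of the arc stays the same or, at its bottleneck, changes to the
parent component. Hence foreign arcs form no closed walk. -/
theorem acyclic_foreign (D : IsReuniclusDecomposition G B r parent comp) {F : V → V → Prop}
    (hF : ∀ x y, F x y → G.Adj x y ∧ ∃ b ∈ B, b ≠ x ∧ x ∈ comp b ∧ y ∈ comp b) (v : V) :
    ¬ Relation.TransGen F v v := by
  obtain ⟨d, hd⟩ := D.exists_depth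
  have hup : ∀ x, ∃ b, x ≠ r → b ∈ B ∧ b ≠ x ∧ x ∈ comp b := by
    intro x
    by_cases hx : x = r
    · exact ⟨x, fun h => (h hx).elim⟩
    · obtain ⟨b, h⟩ := D.exists_upper hx
      exact ⟨b, fun _ => h⟩
  choose up hup using hup
  -- the depth of the component of the foreign arcs that leave a vertex
  let e : V → ℕ := fun x => if x = r then 0 else d (up x) + 1
  let S : V → V → Prop := fun x y => G.Adj x y ∧ up x ∈ B ∧ x ∈ comp (up x) ∧ y ∈ comp (up x) ∧
    up y = up x ∧ x ≠ up x ∧ y ≠ up x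
  have hstep : ∀ x y, F x y → e y < e x ∨ e y = e x ∧ S x y := by
    intro x y hxy
    obtain ⟨hadj, b, hb, hbx, hxb, hyb⟩ := hF x y hxy
    have hxr : x ≠ r := by
      rintro rfl
      exact hbx ((D.mem_root b hb).1 hxb)
    obtain ⟨hu1, hu2, hu3⟩ := hup x hxr
    obtain rfl : b = up x := D.comp_unique hb hu1 hxb hu3 hbx hu2
    by_cases hyr : y = r
    · simp [e, hyr, hxr]
    obtain ⟨hv1, hv2, hv3⟩ := hup y hyr
    by_cases hy : y = up x
    · left
      have hpar : up y = parent y :=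
        ((D.mem_nonroot y (hy ▸ hb) hyr _ hv1).1 hv3).resolve_left hv2
      have := hd y (hy ▸ hb) hyr
      simp only [e, hyr, hxr, if_false, ← hy, hpar]
      omega
    · right
      have hyx : up y = up x := D.comp_unique hv1 hb hv3 hyb hv2 (Ne.symm hy)
      exact ⟨by simp [e, hyr, hxr, hyx], hadj, hb, hxb, hyb, hyx, Ne.symm hbx, hy⟩
  have htrans : ∀ y, Relation.TransGen F v y → e y < e v ∨ e y = e v ∧ Relation.TransGen S v y := by
    intro y h
    induction h with
    | single h => exact (hstep _ _ h).imp_right fun h => ⟨h.1, .single h.2⟩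
    | tail _ h ih =>
      rcases hstep _ _ h with h1 | ⟨h1, h2⟩ <;> rcases ih with h3 | ⟨h3, h4⟩
      · exact .inl (h1.trans h3)
      · exact .inl (h3 ▸ h1)
      · exact .inl (h1 ▸ h3)
      · exact .inr ⟨h1.trans h3, h4.tail h2⟩
  intro h
  have hS := ((htrans v h).resolve_left (lt_irrefl _)).2
  obtain ⟨z, ⟨-, hb, hvb, -⟩, -⟩ := Relation.TransGen.head'_iff.1 hS
  have hlift : ∀ y, Relation.TransGen S v y → up y = up v ∧ ∃ hy : y ∈ comp (up v),
      Relation.TransGen (fun y z : comp (up v) => G.Adj y z ∧ (y : V) ≠ up v ∧ (z : V) ≠ up v)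
        ⟨v, hvb⟩ ⟨y, hy⟩ := by
    intro y h
    induction h with
    | single h =>
      obtain ⟨h1, -, -, h2, h3, h4⟩ := h
      exact ⟨h3, h2, .single ⟨h1, h4⟩⟩
    | tail _ h ih =>
      obtain ⟨h1, -, -, h2, h3, h4⟩ := h
      obtain ⟨i1, i2, i3⟩ := ih
      rw [i1] at h2 h3 h4
      exact ⟨h3, h2, i3.tail ⟨h1, h4⟩⟩
  exact D.acyclic_comp hb _ (hlift v hS).2.2

/-- The arcs of each component are labelled by its bottleneck. -/
theorem exists_isScheme [Finite V] (D : IsReuniclusDecomposition G B r parent comp)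
    (hG : IsSwapDigraph G) : ∃ lab m, IsScheme G lab m := by
  have hne : ∀ x y, G.Adj x y → x ≠ y := by
    rintro x _ h rfl
    exact hG.loopless x h
  have hlab : ∀ x y, ∃ b, G.Adj x y → b ∈ B ∧ x ∈ comp b ∧ y ∈ comp b := by
    intro x y
    by_cases h : G.Adj x y
    · obtain ⟨b, hb⟩ := D.arc_mem x y h
      exact ⟨b, fun _ => hb⟩
    · exact ⟨x, fun h' => (h h').elim⟩
  choose lab hlab using hlab
  have huniq : ∀ b ∈ B, ∀ x ∈ comp b, ∀ y ∈ comp b, G.Adj x y → lab x y = b := by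
    intro b hb x hx y hy hxy
    obtain ⟨h1, h2, h3⟩ := hlab x y hxy
    exact D.comp_unique_of_ne (hne x y hxy) h1 hb h2 h3 hx hy
  obtain ⟨m, hm⟩ := exists_rank (F := fun x y => G.Adj x y ∧ lab x y ≠ x)
    (D.acyclic_foreign fun x y h => ⟨h.1, lab x y, (hlab x y h.1).1, h.2, (hlab x y h.1).2⟩)
  refine ⟨lab, m, fun a b h1 h2 => hm a b ⟨h1, h2⟩, ?_, ?_, ?_⟩
  · intro a b c hab hbc hne
    obtain ⟨h1, h2, h3⟩ := hlab a b hab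
    obtain ⟨h4, h5, h6⟩ := hlab b c hbc
    by_cases hb : lab a b = b
    · exact .inl hb
    · exact .inr (D.comp_unique h1 h4 h3 h5 hb hne)
  · intro a b hab hne
    obtain ⟨h1, h2, h3⟩ := hlab a b hab
    obtain ⟨hmem, hbot⟩ := D.bottleneck _ h1
    rcases Relation.ReflTransGen.cases_tail (hbot.1 ⟨_, hmem⟩ ⟨a, h2⟩) with h | ⟨c, -, hc⟩
    · exact (hne (congrArg Subtype.val h).symm).elim
    · exact ⟨c, hc, huniq _ h1 _ c.2 _ h2 hc⟩
  · intro a b hab hne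
    obtain ⟨h1, h2, h3⟩ := hlab a b hab
    obtain ⟨hmem, hbot⟩ := D.bottleneck _ h1
    rcases Relation.ReflTransGen.cases_head (hbot.1 ⟨b, h3⟩ ⟨_, hmem⟩) with h | ⟨c, hc, -⟩
    · exact (hne (congrArg Subtype.val h).symm).elim
    · exact ⟨c, hc, huniq _ h1 _ h3 _ c.2 hc⟩

end IsReuniclusDecomposition

theorem IsReuniclus.exists_live_safe [Finite V] {G : Digraph V} (hG : IsSwapDigraph G)
    (h : IsReuniclus G) : ∃ P : Protocol V, Live G P ∧ Safe G P := by
  obtain ⟨B, r, parent, comp, D⟩ := h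
  obtain ⟨lab, m, hs⟩ := D.exists_isScheme hG
  obtain ⟨N, hN⟩ := (Set.finite_range m).bddAbove
  have hN' : ∀ v, m v ≤ N := fun v => hN ⟨v, rfl⟩
  refine ⟨_, live_schemeProtocol hs hN', safe_schemeProtocol hG (fun a b hab hne => ?_) hs.incoming⟩
  have := hs.rank_lt a b hab hne
  have := hN' b
  omega

/-! ### From contract labels to a reuniclus decomposition -/

theorem isArticulation_of_separation [Finite V] {G : Digraph V} (hG : StronglyConnected G)
    {b x y : V} {W : Set V}
    (hW : ∀ x y, x ≠ b → y ≠ b → G.Adj x y → (x ∈ W ↔ y ∈ W))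
    (hxb : x ≠ b) (hyb : y ≠ b) (hx : x ∈ W) (hy : y ∉ W) : IsArticulation G b := by
  have h1 : Subsingleton G.toSimpleGraphInclusive.ConnectedComponent := by
    apply SimpleGraph.Preconnected.subsingleton_connectedComponent
    intro u v
    induction hG u v with
    | refl => exact SimpleGraph.Reachable.refl _
    | @tail c d _ hcd ih =>
      by_cases h : c = d
      · exact h ▸ ih
      · exact ih.trans (SimpleGraph.Adj.reachable (SimpleGraph.fromRel_adj _ _ _ |>.2 ⟨h, .inl hcd⟩))
  have h2 : Nontrivial (G.toSimpleGraphInclusive.induce {b}ᶜ).ConnectedComponent := by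
    refine ⟨SimpleGraph.connectedComponentMk _ ⟨x, hxb⟩, SimpleGraph.connectedComponentMk _ ⟨y, hyb⟩,
      fun h => ?_⟩
    obtain ⟨p⟩ := SimpleGraph.ConnectedComponent.exact h
    have key : ∀ (u v : ({b}ᶜ : Set V)), (G.toSimpleGraphInclusive.induce {b}ᶜ).Walk u v →
        ((u : V) ∈ W ↔ (v : V) ∈ W) := by
      intro u v p
      induction p with
      | nil => rfl
      | @cons u v w h _ ih =>
        refine Iff.trans ?_ ih
        obtain ⟨-, h | h⟩ := SimpleGraph.fromRel_adj _ _ _ |>.1 h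
        · exact hW _ _ u.2 v.2 h
        · exact (hW _ _ v.2 u.2 h).symm
    exact hy ((key _ _ p).1 hx)
  exact lt_of_le_of_lt (Finite.card_le_one_iff_subsingleton.2 h1)
    (Finite.one_lt_card_iff_nontrivial.2 h2)

/-- What an atomic protocol tells about the arcs: `lab a b` is the party whose hashlock protects the
contract on `(a, b)`, and `cr a b` and `cl a b` are the time steps in which it is created and
claimed in the execution without deviations. -/
structure IsLabelling (G : Digraph V) (lab : V → V → V) (cr cl : V → V → ℕ) : Prop where
  incoming : ∀ a b c, G.Adj a b → G.Adj b c → lab b c ≠ b →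
    cr a b < cr b c ∧ (lab a b = b ∨ lab a b = lab b c)
  exists_next : ∀ a b, G.Adj a b → lab a b ≠ b →
    ∃ c, G.Adj b c ∧ lab b c = lab a b ∧ cl b c < cl a b
  /-- The first claim, of `(p, q)`, is made with the secret of `q`. If `q` has protected an outgoing
  contract with it, then it must be able to open all its incoming contracts without other secrets. -/
  first : ∃ p q, G.Adj p q ∧ lab p q = q ∧
    ((∃ c, G.Adj q c ∧ lab q c = q) → ∀ a, G.Adj a q → lab a q = q)

/-- An arc whose contract is protected by the hashlock of `z`. -/
def LabelArc (G : Digraph V) (lab : V → V → V) (z a b : V) : Prop :=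
  G.Adj a b ∧ lab a b = z

/-- The component of `z`: the vertices reached from `z` through arcs labelled `z`. -/
def labelComp (G : Digraph V) (lab : V → V → V) (z : V) : Set V :=
  {v | Relation.ReflTransGen (LabelArc G lab z) z v}

namespace IsLabelling

variable {G : Digraph V} {lab : V → V → V} {cr cl : V → V → ℕ}

/-- The latest creation time of an incoming contract increases along foreign arcs. -/
theorem exists_rank [Finite V] (h : IsLabelling G lab cr cl) :
    ∃ m : V → ℕ, ∀ a b, G.Adj a b → lab a b ≠ a → m a < m b := by
  have := Fintype.ofFinite V
  refine ⟨fun b => Finset.univ.sup fun a => if G.Adj a b then cr a b + 1 else 0,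
    fun b c hbc hne => ?_⟩
  refine lt_of_lt_of_le (Nat.lt_succ_of_le (Finset.sup_le (a := cr b c) fun a _ => ?_)) ?_
  · by_cases hab : G.Adj a b
    · simpa [hab] using (h.incoming a b c hab hbc hne).1
    · simp [hab]
  · refine le_trans ?_ (Finset.le_sup (Finset.mem_univ b))
    simp [hbc]

/-- If all arcs into `v` are labelled `v`, then every vertex has a path of foreign arcs to `v`: the
set of vertices with such a path contains the labels of all arcs that enter it, so an arc entering
it from outside would be foreign. -/
theorem foreign_path (hG : StronglyConnected G) (h : IsLabelling G lab cr cl) {v : V}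
    (hv : ∀ a, G.Adj a v → lab a v = v) (x : V) :
    Relation.ReflTransGen (fun a b => G.Adj a b ∧ lab a b ≠ a) x v := by
  have hlab : ∀ x, Relation.ReflTransGen (fun a b => G.Adj a b ∧ lab a b ≠ a) x v →
      ∀ a, G.Adj a x → Relation.ReflTransGen (fun a b => G.Adj a b ∧ lab a b ≠ a) (lab a x) v := by
    intro x hx
    induction hx using Relation.ReflTransGen.head_induction_on with
    | refl =>
      intro a ha
      rw [hv a ha]
    | @head x y hxy hyv ih =>
      intro a ha
      rcases (h.incoming a x y ha hxy.1 hxy.2).2 with h1 | h1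
      · rw [h1]
        exact hyv.head hxy
      · rw [h1]
        exact ih x hxy.1
  induction hG x v using Relation.ReflTransGen.head_induction_on with
  | refl => exact .refl
  | @head x y hxy _ ih =>
    by_contra hx
    exact hx (ih.head ⟨hxy, fun hl => hx (hl ▸ hlab y ih x hxy)⟩)

variable {m : V → ℕ}

theorem rank_le (hm : ∀ a b, G.Adj a b → lab a b ≠ a → m a < m b) {x y : V}
    (h : Relation.ReflTransGen (fun a b => G.Adj a b ∧ lab a b ≠ a) x y) : x = y ∨ m x < m y := by
  induction h with
  | refl => exact .inl rfl
  | @tail b c _ hbc ih =>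
    have := hm b c hbc.1 hbc.2
    rcases ih with rfl | ih
    · exact .inr this
    · exact .inr (ih.trans this)

/-- The label of a foreign arc occurs on an arc entering its seller. -/
theorem exists_prev (hG : StronglyConnected G) (h : IsLabelling G lab cr cl)
    (hm : ∀ a b, G.Adj a b → lab a b ≠ a → m a < m b) {a b : V} (hab : G.Adj a b)
    (hne : lab a b ≠ a) : ∃ c, G.Adj c a ∧ lab c a = lab a b := by
  by_cases hroot : ∀ c, G.Adj c a → lab c a = a
  · have h1 := hm a b hab hne
    rcases rank_le hm (foreign_path hG h hroot b) with h2 | h2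
    · exact (h1.ne (h2 ▸ rfl)).elim
    · exact (lt_asymm h1 h2).elim
  · push Not at hroot
    obtain ⟨c, hc, hl⟩ := hroot
    exact ⟨c, hc, (h.incoming c a b hc hab hne).2.resolve_left hl⟩

/-- Traced backwards by `exists_prev`, a label leads to the party that owns it. -/
theorem path_from_label (hG : StronglyConnected G) (h : IsLabelling G lab cr cl)
    (hm : ∀ a b, G.Adj a b → lab a b ≠ a → m a < m b) {z a b : V} (hab : LabelArc G lab z a b) :
    a ∈ labelComp G lab z := by
  induction hn : m a using Nat.strong_induction_on generalizing a b with
  | _ n ih =>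
    subst hn
    by_cases hza : z = a
    · exact hza ▸ .refl
    · obtain ⟨c, hc, hl⟩ := exists_prev hG h hm hab.1 (hab.2.symm ▸ hza)
      rw [hab.2] at hl
      by_cases hzc : z = c
      · subst hzc
        exact .single ⟨hc, hl⟩
      · exact Relation.ReflTransGen.tail (ih (m c) (hm c a hc (hl.symm ▸ hzc)) ⟨hc, hl⟩ rfl) ⟨hc, hl⟩

/-- A party opens a contract protected by another party's hashlock only after an outgoing contract
with the same hashlock was claimed; following such arcs, the claims get earlier. -/
theorem path_to_label (h : IsLabelling G lab cr cl) {z a b : V} (hab : LabelArc G lab z a b) :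
    Relation.ReflTransGen (LabelArc G lab z) b z := by
  induction hn : cl a b using Nat.strong_induction_on generalizing a b with
  | _ n ih =>
    subst hn
    by_cases hzb : z = b
    · exact hzb ▸ .refl
    · obtain ⟨c, hc, hl, hlt⟩ := h.exists_next a b hab.1 (hab.2.symm ▸ hzb)
      have hbc : LabelArc G lab z b c := ⟨hc, hl.trans hab.2⟩
      exact (ih _ hlt hbc rfl).head hbc

theorem path_to_of_mem (h : IsLabelling G lab cr cl) {z v : V} (hv : v ∈ labelComp G lab z) :
    Relation.ReflTransGen (LabelArc G lab z) v z := by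
  rcases Relation.ReflTransGen.cases_tail hv with rfl | ⟨u, -, hu⟩
  · exact .refl
  · exact h.path_to_label hu

theorem rank_lt_of_mem (h : IsLabelling G lab cr cl)
    (hm : ∀ a b, G.Adj a b → lab a b ≠ a → m a < m b) {z v : V} (hv : v ∈ labelComp G lab z)
    (hne : v ≠ z) : m v < m z := by
  have hp := h.path_to_of_mem hv
  clear hv
  have : v = z ∨ m v < m z := by
    clear hne
    induction hp using Relation.ReflTransGen.head_induction_on with
    | refl => exact .inl rfl
    | @head x y hxy _ ih =>
      by_cases hx : x = z
      · exact .inl hx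
      · have := hm x y hxy.1 (hxy.2.symm ▸ Ne.symm hx)
        rcases ih with rfl | ih
        · exact .inr this
        · exact .inr (this.trans ih)
  exact this.resolve_left hne

theorem mem_labelComp_iff {z v : V} : v ∈ labelComp G lab z ↔ v = z ∨
    ∃ u ∈ labelComp G lab z, LabelArc G lab z u v := by
  constructor
  · intro h
    rcases Relation.ReflTransGen.cases_tail h with h | ⟨u, hu, huv⟩
    · exact .inl h
    · exact .inr ⟨u, hu, huv⟩
  · rintro (rfl | ⟨u, hu, huv⟩)
    · exact .refl
    · exact Relation.ReflTransGen.tail hu huv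

/-- The labels of an atomic protocol decompose the digraph. The components are formed by the arcs
with the same label, the root is the party that makes the first claim, and the parent of a label
`b` is the unique other label that occurs at `b`. -/
theorem isReuniclus [Finite V] (hG : IsSwapDigraph G) (h : IsLabelling G lab cr cl) :
    IsReuniclus G := by
  have hsc := hG.stronglyConnected
  obtain ⟨m, hm⟩ := h.exists_rank
  obtain ⟨p, r, hpr, hlpr, hfirst⟩ := h.first
  have hne : p ≠ r := fun e => hG.loopless r (e ▸ hpr)
  -- the path from `r` to `p` starts with an arc that is labelled by its seller
  have hroot : ∀ a, G.Adj a r → lab a r = r := by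
    refine hfirst ?_
    rcases Relation.ReflTransGen.cases_head (path_from_label hsc h hm ⟨hpr, hlpr⟩) with e | ⟨c, hc, -⟩
    · exact (hne e.symm).elim
    · exact ⟨c, hc⟩
  have hup : ∀ v, ∃ x, v ≠ r → x ≠ v ∧ (∃ a b, LabelArc G lab x a b) ∧ v ∈ labelComp G lab x ∧
      ∀ z, v ∈ labelComp G lab z → z = v ∨ z = x := by
    intro v
    by_cases hv : v = r
    · exact ⟨v, fun h => (h hv).elim⟩
    have hnr : ¬ ∀ a, G.Adj a v → lab a v = v := by
      intro hv'
      rcases rank_le hm (foreign_path hsc h hv' r) with e | h1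
      · exact hv e.symm
      · rcases rank_le hm (foreign_path hsc h hroot v) with e | h2
        · exact hv e
        · exact lt_asymm h1 h2
    push Not at hnr
    obtain ⟨a, hav, hl⟩ := hnr
    obtain ⟨w, hvw, hl', -⟩ := h.exists_next a v hav hl
    refine ⟨lab a v, fun _ => ⟨hl, ⟨a, v, hav, rfl⟩, path_from_label hsc h hm ⟨hvw, hl'⟩, ?_⟩⟩
    intro z hz
    rcases mem_labelComp_iff.1 hz with e | ⟨u, -, huv⟩
    · exact .inl e.symm
    · rw [← hl', ← huv.2]
      exact (h.incoming u v w huv.1 hvw (hl' ▸ hl)).2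
  choose up hup using hup
  have hrootComp : ∀ z, r ∈ labelComp G lab z → z = r := by
    intro z hz
    rcases mem_labelComp_iff.1 hz with e | ⟨u, -, huv⟩
    · exact e.symm
    · exact huv.2.symm.trans (hroot u huv.1)
  -- an arc inside a component carries the label of the component
  have hind : ∀ z x y, x ∈ labelComp G lab z → y ∈ labelComp G lab z → G.Adj x y → lab x y = z := by
    intro z x y hx hy hxy
    have hx' : x ∈ labelComp G lab (lab x y) := path_from_label hsc h hm ⟨hxy, rfl⟩
    have hy' : y ∈ labelComp G lab (lab x y) := Relation.ReflTransGen.tail hx' ⟨hxy, rfl⟩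
    have hxy' : x ≠ y := fun e => hG.loopless y (e ▸ hxy)
    by_contra hz
    have key : ∀ v, v ∈ labelComp G lab z → v ∈ labelComp G lab (lab x y) → z = v ∨ lab x y = v := by
      intro v h1 h2
      by_cases hv : v = r
      · subst hv
        exact .inl (hrootComp z h1)
      · rcases (hup v hv).2.2.2 z h1 with e | e
        · exact .inl e
        · rcases (hup v hv).2.2.2 _ h2 with e' | e'
          · exact .inr e'
          · exact (hz (e'.trans e.symm)).elim
    rcases key x hx hx' with e1 | e1 <;> rcases key y hy hy' with e2 | e2
    · exact hxy' (e1.symm.trans e2)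
    · rw [e1] at hy
      rw [e2] at hx'
      exact lt_asymm (h.rank_lt_of_mem hm hy hxy'.symm) (h.rank_lt_of_mem hm hx' hxy')
    · rw [e2] at hx
      rw [e1] at hy'
      exact lt_asymm (h.rank_lt_of_mem hm hx hxy') (h.rank_lt_of_mem hm hy' hxy'.symm)
    · exact hxy' (e1.symm.trans e2)
  let parent : V → V := fun v => if v = r then r else up v
  have hpar : ∀ v, v ≠ r → parent v = up v := fun v hv => if_neg hv
  have hparr : ∀ n, parent^[n] r = r := fun n => Function.iterate_fixed (f := parent) (if_pos rfl) n
  refine ⟨{z | ∃ a b, LabelArc G lab z a b}, r, parent, labelComp G lab, ?_, ?_, ?_, ?_, ?_, ?_, ?_,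
    ?_, ?_⟩
  · exact ⟨p, r, hpr, hlpr⟩
  · intro b _ hb
    rw [hpar b hb]
    exact (hup b hb).2.1
  · obtain ⟨N, hN⟩ := (Set.finite_range m).bddAbove
    intro b _
    induction hn : N - m b using Nat.strong_induction_on generalizing b with
    | _ n ih =>
      by_cases hb : b = r
      · exact ⟨0, hb⟩
      · have h1 := h.rank_lt_of_mem hm (hup b hb).2.2.1 (hup b hb).1.symm
        have h2 : m (up b) ≤ N := hN ⟨_, rfl⟩
        obtain ⟨k, hk⟩ := ih (N - m (up b)) (by omega) (up b) (hup b hb).2.1 rfl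
        refine ⟨k + 1, ?_⟩
        rw [Function.iterate_succ_apply, hpar b hb, hk]
  · rintro b -
    refine ⟨.refl, ?_, ?_⟩
    · have lift : ∀ (x : labelComp G lab b) y, Relation.ReflTransGen (LabelArc G lab b) x y →
          ∃ hy : y ∈ labelComp G lab b,
            Relation.ReflTransGen (inducedOn G (labelComp G lab b)).Adj x ⟨y, hy⟩ := by
        intro x y hxy
        induction hxy with
        | refl => exact ⟨x.2, .refl⟩
        | tail _ hyz ih =>
          obtain ⟨hy, hp⟩ := ih
          exact ⟨Relation.ReflTransGen.tail hy hyz, hp.tail hyz.1⟩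
      exact fun x y => (lift x y ((h.path_to_of_mem x.2).trans y.2)).2
    · intro c hc
      by_contra hbc
      obtain ⟨⟨-, hch, -⟩, h2, hends⟩ := hc
      -- all arcs of a cycle that avoids `b` are foreign, hence the rank increases
      have hch' : c.IsChain (fun x y : labelComp G lab b => m x < m y) := by
        refine List.IsChain.imp_of_mem_imp (fun x y hx _ hxy => ?_) hch
        refine hm x y hxy fun hl => hbc ?_
        rw [hind b x y x.2 y.2 hxy] at hl
        have : x = ⟨b, .refl⟩ := Subtype.ext hl.symm
        exact this ▸ hx
      match c, hch', h2, hends with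
      | x :: y :: l, hch', _, hends =>
        have hpw : (x :: y :: l).Pairwise (fun x y : labelComp G lab b => m x < m y) :=
          List.isChain_iff_pairwise.1 hch'
        have hlast := (List.pairwise_cons.1 hpw).1 x (by
          rw [List.head?_cons, List.getLast?_cons_cons] at hends
          exact List.mem_of_getLast? hends.symm)
        exact lt_irrefl _ hlast
  · intro x y hxy
    have hx := path_from_label hsc h hm (z := lab x y) ⟨hxy, rfl⟩
    exact ⟨lab x y, ⟨x, y, hxy, rfl⟩, hx, Relation.ReflTransGen.tail hx ⟨hxy, rfl⟩⟩
  · intro x hx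
    have hxr : x ≠ r := by
      rintro rfl
      exact hx ⟨p, x, hpr, hlpr⟩
    obtain ⟨-, h1, h2, h3⟩ := hup x hxr
    refine ⟨up x, ⟨h1, h2⟩, fun z hz => (h3 z hz.2).resolve_left ?_⟩
    rintro rfl
    exact hx hz.1
  · exact fun c _ => ⟨hrootComp c, fun e => e ▸ .refl⟩
  · intro b _ hb c _
    rw [hpar b hb]
    refine ⟨(hup b hb).2.2.2 c, ?_⟩
    rintro (rfl | rfl)
    · exact .refl
    · exact (hup b hb).2.2.1
  · rintro b ⟨a₀, b₀, hab₀⟩ hb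
    -- the components of the descendants of `b` are attached to the others only at `b`
    have hdesc : ∀ x z c, x ≠ b → x ∈ labelComp G lab z → x ∈ labelComp G lab c →
        (∃ n, parent^[n] c = b) → ∃ n, parent^[n] z = b := by
      rintro x z c hxb hxz hxc ⟨n, hn⟩
      by_cases hx : x = r
      · subst hx
        rw [hrootComp z hxz, ← hrootComp c hxc]
        exact ⟨n, hn⟩
      rcases (hup x hx).2.2.2 z hxz with e | e <;> rcases (hup x hx).2.2.2 c hxc with e' | e'
      · exact ⟨n, by rwa [e, ← e']⟩
      · exact ⟨n + 1, by rw [Function.iterate_succ_apply, e, hpar x hx, ← e', hn]⟩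
      · rw [e'] at hn
        rcases n with _ | n
        · exact (hxb hn).elim
        · exact ⟨n, by rwa [Function.iterate_succ_apply, hpar x hx, ← e] at hn⟩
      · exact ⟨n, by rwa [e, ← e']⟩
    have hb₀ : b ∈ labelComp G lab b := .refl
    have hout : ∃ y, LabelArc G lab b b y := by
      rcases Relation.ReflTransGen.cases_head (path_from_label hsc h hm hab₀) with e | ⟨y, hy, -⟩
      · exact ⟨b₀, by rwa [← e] at hab₀⟩
      · exact ⟨y, hy⟩
    obtain ⟨y, hy⟩ := hout
    refine isArticulation_of_separation hsc (x := y) (y := r)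
      (W := {x | ∃ c, x ∈ labelComp G lab c ∧ ∃ n, parent^[n] c = b}) ?_ ?_ (Ne.symm hb) ?_ ?_
    · intro x y hxb hyb hxy
      have hx := path_from_label hsc h hm (z := lab x y) ⟨hxy, rfl⟩
      have hy : y ∈ labelComp G lab (lab x y) := Relation.ReflTransGen.tail hx ⟨hxy, rfl⟩
      constructor
      · rintro ⟨c, hc, hd⟩
        exact ⟨_, hy, hdesc x _ c hxb hx hc hd⟩
      · rintro ⟨c, hc, hd⟩
        exact ⟨_, hx, hdesc y _ c hyb hy hc hd⟩
    · rintro rfl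
      exact hG.loopless y hy.1
    · exact ⟨b, Relation.ReflTransGen.single hy, 0, rfl⟩
    · rintro ⟨c, hc, n, hn⟩
      rw [hrootComp c hc, hparr n] at hn
      exact hb hn.symm

end IsLabelling

/-! ### Attacks on a single compliant party -/

theorem State.ext_fields {s s' : State V} (h₁ : s.paired = s'.paired)
    (h₂ : s.contract = s'.contract) (h₃ : s.claimed = s'.claimed) (h₄ : s.told = s'.told) :
    s = s' := by
  cases s
  cases s'
  subst h₁ h₂ h₃ h₄
  rfl

theorem Config.ext_fields {k k' : Config V} (h₁ : k.state = k'.state) (h₂ : k.hist = k'.hist) :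
    k = k' := by
  cases k
  cases k'
  subst h₁ h₂
  rfl

theorem State.CanUseLock.mono {s : State V} {C : Set V} {m m' : Move V} {v : V} {h : Hashlock V}
    (hm : m.createPair → m'.createPair) (hc : s.CanUseLock ∅ m v h) : s.CanUseLock C m' v h := by
  rcases hc with ⟨h1, h2⟩ | h1 | ⟨h1, -⟩
  · exact .inl ⟨h1, hm h2⟩
  · exact .inr (.inl h1)
  · exact h1.elim

theorem State.canUseLock_iff {s : State V} {C : Set V} {m : Move V} {v : V} {h : Hashlock V}
    (hv : v ∉ C) : s.CanUseLock C m v h ↔ s.CanUseLock ∅ m v h := by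
  simp [State.CanUseLock, hv]

theorem State.canOpen_iff {s : State V} {C : Set V} {v : V} {h : Hashlock V}
    (hv : v ∉ C) : s.CanOpen C v h ↔ s.KnowsSecret v h := by
  simp [State.CanOpen, hv]

/-- The move that redoes everything that `v` has achieved in the state `s'`. -/
def State.redo (s' : State V) (v : V) : Move V where
  createPair := v ∈ s'.paired
  create w := s'.contract v w
  claim := {u | s'.claimed u v}
  tell w := s'.told v w

/-- A coalition can imitate compliant behavior. Redoing the effects of the compliant moves instead of
repeating these moves matters: the coalition has more abilities, so that moves without effect could
become effective. -/
theorem State.step_redo {G : Digraph V} {C : Set V} {t : ℕ} {s : State V} {mv₀ mv : V → Move V}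
    (h₁ : ∀ v ∉ C, mv v = mv₀ v) (h₂ : ∀ v ∈ C, mv v = (s.step G ∅ t mv₀).redo v) :
    s.step G C t mv = s.step G ∅ t mv₀ := by
  have hpair : ∀ v, (mv₀ v).createPair → (mv v).createPair := by
    intro v hv
    by_cases hC : v ∈ C
    · rw [h₂ v hC]
      exact .inr hv
    · rwa [h₁ v hC]
  have e1 : (s.step G C t mv).paired = (s.step G ∅ t mv₀).paired := by
    ext v
    refine ⟨?_, fun h => h.imp_right (hpair v)⟩
    rintro (h | h)
    · exact .inl h
    · by_cases hC : v ∈ C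
      · change (mv v).createPair at h
        rw [h₂ v hC] at h
        exact h
      · change (mv v).createPair at h
        rw [h₁ v hC] at h
        exact .inr h
  have e2 : (s.step G C t mv).contract = (s.step G ∅ t mv₀).contract := by
    funext a b
    ext c
    rw [State.step_contract_eq_some_iff]
    by_cases hC : a ∈ C
    · constructor
      · rintro (h | ⟨-, -, h, -⟩)
        · exact State.step_contract_eq_some_iff.2 (.inl h)
        · rw [h₂ a hC] at h
          exact h
      · intro h
        refine (State.step_contract_eq_some_iff.1 h).imp_right ?_
        rintro ⟨h1, h2, h3, h4⟩
        refine ⟨h1, h2, ?_, h4.mono (hpair a)⟩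
        rw [h₂ a hC]
        exact h
    · rw [State.step_contract_eq_some_iff, h₁ a hC, State.canUseLock_iff hC]
  have e3 : (s.step G C t mv).claimed = (s.step G ∅ t mv₀).claimed := by
    funext a b
    refine propext ?_
    by_cases hC : b ∈ C
    · constructor
      · rintro (h | ⟨h, -⟩)
        · exact .inl h
        · rw [h₂ b hC] at h
          exact h
      · intro h
        refine h.imp_right ?_
        rintro ⟨-, c, h2, h3, h4⟩
        refine ⟨?_, c, h2, h3, .inl ((State.canOpen_iff (Set.notMem_empty b)).1 h4)⟩
        rw [h₂ b hC]
        exact h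
    · simp only [State.step, h₁ b hC, State.canOpen_iff hC, State.canOpen_iff (Set.notMem_empty b)]
  have e4 : (s.step G C t mv).told = (s.step G ∅ t mv₀).told := by
    funext a b
    ext h
    by_cases hC : a ∈ C
    · constructor
      · rintro (h' | ⟨h', -⟩)
        · exact .inl h'
        · rw [h₂ a hC] at h'
          exact h'
      · intro h'
        refine h'.imp_right ?_
        rintro ⟨-, h2⟩
        refine ⟨?_, h2.mono (hpair a)⟩
        rw [h₂ a hC]
        exact h'
    · simp only [State.step, h₁ a hC, State.canUseLock_iff hC]
  exact State.ext_fields e1 e2 e3 e4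

section Attack

variable (G : Digraph V) (P : Protocol V) (adv₀ : ℕ → V → Move V)

/-- The attack of all other parties on `v`: before time `t` they imitate compliant behavior, then
they stop creating contracts, and the only later claim, at time `t + 1`, is that of the asset
`(v, w)` by `w`. -/
noncomputable def attack (v w : V) (t : ℕ) (k : ℕ) (u : V) : Move V :=
  if k < t then (run G P ∅ adv₀ (k + 1)).state.redo u
  else ⟨True, fun _ => none, {a | k = t + 1 ∧ u = w ∧ a = v}, fun _ => ∅⟩

variable {G P adv₀} {v w : V} {t : ℕ}

theorem run_attack_eq {k : ℕ} (hk : k ≤ t) :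
    run G P {v}ᶜ (attack G P adv₀ v w t) k = run G P ∅ adv₀ k := by
  induction k with
  | zero => rfl
  | succ k ih =>
    have ih := ih (Nat.le_of_succ_le hk)
    have hst : (run G P {v}ᶜ (attack G P adv₀ v w t) (k + 1)).state =
        (run G P ∅ adv₀ (k + 1)).state := by
      rw [run_succ_state, run_succ_state, ih]
      refine State.step_redo (fun u hu => ?_) fun u hu => ?_
      · rw [moves, moves, if_neg hu, if_neg (Set.notMem_empty u), ih]
      · rw [moves, if_pos hu, attack, if_pos (Nat.lt_of_succ_le hk)]
        rfl
    have hhist : (run G P {v}ᶜ (attack G P adv₀ v w t) (k + 1)).hist =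
        (run G P ∅ adv₀ (k + 1)).hist := by
      funext u
      rw [run_succ_hist, run_succ_hist, hst, ih]
    exact Config.ext_fields hst hhist

theorem moves_attack_self :
    moves G P {v}ᶜ (attack G P adv₀ v w t) t v = moves G P ∅ adv₀ t v := by
  rw [moves, moves, if_neg (by simp), if_neg (by simp), run_attack_eq le_rfl]

theorem moves_attack_of_ne {k : ℕ} (hk : t ≤ k) {u : V} (hu : u ≠ v) :
    moves G P {v}ᶜ (attack G P adv₀ v w t) k u =
      ⟨True, fun _ => none, {a | k = t + 1 ∧ u = w ∧ a = v}, fun _ => ∅⟩ := by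
  have hu : u ∈ ({v}ᶜ : Set V) := hu
  rw [moves, if_pos hu, attack, if_neg hk.not_gt]

theorem contract_of_contract_attack {k : ℕ} (hk : t ≤ k) {a b : V} (ha : a ≠ v) {c : HTLC V}
    (h : (run G P {v}ᶜ (attack G P adv₀ v w t) k).state.contract a b = some c) :
    (run G P ∅ adv₀ t).state.contract a b = some c := by
  induction k, hk using Nat.le_induction with
  | base => rwa [run_attack_eq le_rfl] at h
  | succ k hk ih =>
    rcases State.step_contract_eq_some_iff.1 h with h | ⟨-, -, h, -⟩
    · exact ih h
    · change (moves G P {v}ᶜ (attack G P adv₀ v w t) k a).create b = some c at h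
      rw [moves_attack_of_ne hk ha] at h
      cases h

theorem eq_of_claimed_attack (hG : IsSwapDigraph G)
    (hno : ∀ a b, ¬ (run G P ∅ adv₀ t).state.claimed a b) {k : ℕ} {b : V}
    (h : (run G P {v}ᶜ (attack G P adv₀ v w t) k).state.claimed v b) : b = w := by
  induction k with
  | zero => exact h.elim
  | succ k ih =>
    have hbv : b ≠ v := by
      rintro rfl
      obtain ⟨c, hc⟩ := exists_contract_of_claimed h
      exact hG.loopless _ (adj_of_contract hc)
    by_cases hk : t ≤ k
    · rcases h with h | ⟨h, -⟩
      · exact ih h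
      · change v ∈ (moves G P {v}ᶜ (attack G P adv₀ v w t) k b).claim at h
        rw [moves_attack_of_ne hk hbv] at h
        exact h.2.1
    · rw [run_attack_eq (Nat.succ_le_of_lt (not_le.1 hk))] at h
      exact (hno _ _ (claimed_mono (Nat.succ_le_of_lt (not_le.1 hk)) h)).elim

/-- In a safe protocol, consider the time step `t` of the execution without deviations, before any
claim. If the other parties are able to open the contract on `(v, w)` after this step, because its
hashlock is not that of `v` or because `v` reveals its secret in this step, then all incoming
contracts of `v` are already in place, and `v` can open them with its own secret and the one
protecting `(v, w)`. -/
theorem incoming_of_safe (hG : IsSwapDigraph G) (hs : Safe G P)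
    (hno : ∀ a b, ¬ (run G P ∅ adv₀ t).state.claimed a b) {c : HTLC V} {x : V}
    (hc : (run G P ∅ adv₀ (t + 1)).state.contract v w = some c) (hx : c.lock = .party x)
    (ht : t + 1 ≤ c.timeout)
    (hopen : x ≠ v ∨ ∃ p d, (run G P ∅ adv₀ t).state.contract p v = some d ∧ d.lock = .party x ∧
      (run G P ∅ adv₀ (t + 1)).state.claimed p v) {u : V} (hu : G.Adj u v) :
    ∃ d, (run G P ∅ adv₀ t).state.contract u v = some d ∧
      (d.lock = .party v ∨ d.lock = .party x) := by
  have hv : v ∉ ({v}ᶜ : Set V) := by simp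
  have hwv : w ≠ v := by
    rintro rfl
    exact hG.loopless _ (adj_of_contract hc)
  have hrun : run G P {v}ᶜ (attack G P adv₀ v w t) t = run G P ∅ adv₀ t := run_attack_eq le_rfl
  have hc' : (run G P {v}ᶜ (attack G P adv₀ v w t) (t + 1)).state.contract v w = some c := by
    rw [run_succ_state, State.step_contract_eq_some_iff] at hc ⊢
    rwa [hrun, moves_attack_self, State.canUseLock_iff hv]
  have htrans : Transferred G P {v}ᶜ (attack G P adv₀ v w t) v w := by
    refine ⟨t + 1 + 1, .inr ⟨?_, c, hc', ht, .inr ⟨hwv, .inl ?_⟩⟩⟩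
    · change v ∈ (moves G P {v}ᶜ (attack G P adv₀ v w t) (t + 1) w).claim
      rw [moves_attack_of_ne t.le_succ hwv]
      exact ⟨rfl, rfl, rfl⟩
    · rcases hopen with hxv | ⟨p, d, hd, hdx, hcl⟩
      · refine ⟨x, hxv, .inl ⟨hx, .inr ?_⟩⟩
        change (moves G P {v}ᶜ (attack G P adv₀ v w t) t x).createPair
        rw [moves_attack_of_ne le_rfl hxv]
        trivial
      · have hpv : p ≠ v := by
          rintro rfl
          exact hG.loopless _ (adj_of_contract hd)
        refine ⟨p, hpv, .inr ⟨v, d, ?_, hdx.trans hx.symm, ?_⟩⟩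
        · exact contract_mono t.le_succ (by rwa [hrun])
        · rcases hcl with hcl | ⟨h1, e, h2, h3, h4⟩
          · exact (hno _ _ hcl).elim
          · refine .inr ⟨?_, e, ?_, h3, .inl ?_⟩
            · change p ∈ (moves G P {v}ᶜ (attack G P adv₀ v w t) t v).claim
              rw [moves_attack_self]
              exact h1
            · rwa [hrun]
            · rw [hrun]
              exact (State.canOpen_iff (Set.notMem_empty v)).1 h4
  obtain ⟨k, hk⟩ := (acceptable_singleton_iff hG).1 (hs {v}ᶜ (attack G P adv₀ v w t) v hv) w
    (adj_of_contract hc) htrans u hu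
  obtain ⟨k, -, hk, hk'⟩ := exists_claim hk
  obtain ⟨-, d, hd, -, hd'⟩ := hk'.resolve_left hk
  have htk : t ≤ k := by
    by_contra hlt
    rw [run_attack_eq (Nat.succ_le_of_lt (not_le.1 hlt))] at hk'
    exact hno _ _ (claimed_mono (Nat.succ_le_of_lt (not_le.1 hlt)) hk')
  refine ⟨d, contract_of_contract_attack htk (by rintro rfl; exact hG.loopless _ hu) hd, ?_⟩
  rcases (State.canOpen_iff hv).1 hd' with ⟨h, -⟩ | ⟨b, e, h1, h2, h3⟩
  · exact .inl h
  · obtain rfl := eq_of_claimed_attack hG hno h3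
    obtain rfl := contract_eq_of_eq h1 hc'
    exact .inr (h2.symm.trans hx)

end Attack

/-! ### The labels of an atomic protocol -/

theorem exists_party_of_lock {G : Digraph V} {P : Protocol V} {adv : ℕ → V → Move V} {t : ℕ} :
    (∀ a b c, (run G P ∅ adv t).state.contract a b = some c → ∃ x, c.lock = .party x) ∧
      ∀ a b, ∀ h ∈ (run G P ∅ adv t).state.told a b, ∃ x, h = .party x := by
  induction t with
  | zero => exact ⟨fun _ _ _ h => (by cases h), fun _ _ _ h => h.elim⟩
  | succ t ih =>
    have huse : ∀ v m h, (run G P ∅ adv t).state.CanUseLock ∅ m v h → ∃ x, h = .party x := by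
      rintro v m h (⟨h, -⟩ | (⟨h, -⟩ | ⟨w, c, h1 | h1, rfl⟩ | ⟨w, h⟩) | ⟨h, -⟩)
      · exact ⟨v, h⟩
      · exact ⟨v, h⟩
      · exact ih.1 _ _ _ h1
      · exact ih.1 _ _ _ h1
      · exact ih.2 _ _ _ h
      · exact h.elim
    constructor
    · intro a b c hc
      rcases State.step_contract_eq_some_iff.1 hc with hc | ⟨-, -, -, hc⟩
      · exact ih.1 a b c hc
      · exact huse _ _ _ hc
    · rintro a b h (hh | ⟨-, hh⟩)
      · exact ih.2 a b h hh
      · exact huse _ _ _ hh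

/-- A live and safe protocol labels the arcs: in the execution without deviations, all contracts are
created before the first claim, and the other properties follow from `incoming_of_safe`. -/
theorem exists_isLabelling [Nontrivial V] {G : Digraph V} (hG : IsSwapDigraph G) {P : Protocol V}
    (hl : Live G P) (hs : Safe G P) : ∃ lab cr cl, IsLabelling G lab cr cl := by
  let adv : ℕ → V → Move V := fun _ _ => ⟨False, fun _ => none, ∅, fun _ => ∅⟩
  have hex : ∀ a b, ∃ (c : HTLC V) (x : V) (i j : ℕ), G.Adj a b → c.lock = .party x ∧
      (run G P ∅ adv i).state.contract a b = none ∧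
      (run G P ∅ adv (i + 1)).state.contract a b = some c ∧
      ¬ (run G P ∅ adv j).state.claimed a b ∧ (run G P ∅ adv (j + 1)).state.claimed a b ∧
      i < j ∧ j ≤ c.timeout ∧ (run G P ∅ adv j).state.KnowsSecret b (.party x) := by
    intro a b
    by_cases hab : G.Adj a b
    · obtain ⟨t, ht⟩ := hl adv a b hab
      obtain ⟨j, -, hj, hj'⟩ := exists_claim ht
      obtain ⟨-, c, hc, hjc, hopen⟩ := hj'.resolve_left hj
      obtain ⟨i, hij, hi, hi'⟩ := exists_create hc
      obtain ⟨x, hx⟩ := exists_party_of_lock.1 _ _ _ hc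
      exact ⟨c, x, i, j, fun _ => ⟨hx, hi, hi', hj, hj', hij, hjc,
        hx ▸ (State.canOpen_iff (Set.notMem_empty b)).1 hopen⟩⟩
    · exact ⟨⟨.party a, 0⟩, a, 0, 0, fun h => (hab h).elim⟩
  choose con lab cr cl hex using hex
  have hcr : ∀ {a b t c}, (run G P ∅ adv t).state.contract a b = some c →
      c = con a b ∧ cr a b < t := by
    intro a b t c hc
    obtain ⟨-, h1, h2, -⟩ := hex a b (adj_of_contract hc)
    refine ⟨contract_eq_of_eq hc h2, ?_⟩
    by_contra! h
    rw [contract_mono h hc] at h1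
    cases h1
  have hcl : ∀ {a b t}, (run G P ∅ adv t).state.claimed a b → G.Adj a b ∧ cl a b < t := by
    intro a b t h
    obtain ⟨c, hc⟩ := exists_contract_of_claimed h
    refine ⟨adj_of_contract hc, ?_⟩
    obtain ⟨-, -, -, h1, -⟩ := hex a b (adj_of_contract hc)
    by_contra! hle
    exact h1 (claimed_mono hle h)
  have hlab : ∀ {a b x}, G.Adj a b → (con a b).lock = .party x → lab a b = x := by
    intro a b x hab h
    exact Hashlock.party.inj ((hex a b hab).1.symm.trans h)
  have hnext : ∀ a b, G.Adj a b → lab a b ≠ b →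
      ∃ c, G.Adj b c ∧ lab b c = lab a b ∧ cl b c < cl a b := by
    intro a b hab hne
    obtain ⟨-, -, -, -, -, -, -, h⟩ := hex a b hab
    rcases h with ⟨h, -⟩ | ⟨w, c, h1, h2, h3⟩
    · exact (hne (Hashlock.party.inj h)).elim
    · obtain ⟨hbw, hlt⟩ := hcl h3
      obtain ⟨rfl, -⟩ := hcr h1
      exact ⟨w, hbw, hlab hbw h2, hlt⟩
  -- `s` is the time of the first claim
  have hfirst : ∃ s p q, G.Adj p q ∧ cl p q = s ∧ ∀ a b, G.Adj a b → s ≤ cl a b := by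
    have : ∃ s p q, G.Adj p q ∧ cl p q = s := by
      obtain ⟨x, y, hxy⟩ := exists_pair_ne V
      rcases Relation.ReflTransGen.cases_head (hG.stronglyConnected x y) with e | ⟨z, hz, -⟩
      · exact (hxy e).elim
      · exact ⟨_, x, z, hz, rfl⟩
    obtain ⟨p, q, hpq, h⟩ := Nat.find_spec this
    exact ⟨_, p, q, hpq, h, fun a b hab => Nat.find_min' this ⟨a, b, hab, rfl⟩⟩
  obtain ⟨s, p, q, hpq, hs₀, hmin⟩ := hfirst
  have hno : ∀ t ≤ s, ∀ a b, ¬ (run G P ∅ adv t).state.claimed a b := by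
    intro t ht a b h
    obtain ⟨hab, hlt⟩ := hcl h
    exact absurd (hmin a b hab) (by omega)
  have hpql : lab p q = q := by
    by_contra hne
    obtain ⟨c, hqc, -, hlt⟩ := hnext p q hpq hne
    exact absurd (hmin q c hqc) (by omega)
  have hforeign : ∀ a b c, G.Adj a b → G.Adj b c → lab b c ≠ b → cr b c ≤ s →
      cr a b < cr b c ∧ (lab a b = b ∨ lab a b = lab b c) := by
    intro a b c hab hbc hne hle
    obtain ⟨h1, -, h3, -, -, h6, h7, -⟩ := hex b c hbc
    obtain ⟨d, hd, hd'⟩ := incoming_of_safe hG hs (hno _ hle) h3 h1 (by omega) (.inl hne) hab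
    obtain ⟨rfl, hlt⟩ := hcr hd
    exact ⟨hlt, hd'.imp (hlab hab) (hlab hab)⟩
  -- `q` reveals its secret at time `s`, hence is exposed if it has used it for an own contract
  have hown : ∀ c, G.Adj q c → lab q c = q → cr q c ≤ s → ∀ a, G.Adj a q →
      cr a q < s ∧ lab a q = q := by
    intro c hqc hlq hle a haq
    obtain ⟨h1, -, h3, -, -, -, h7, h8⟩ := hex q c hqc
    have hlt : s < cl q c := by
      refine lt_of_le_of_ne (hmin q c hqc) fun e => ?_
      rw [← e] at h8
      rcases h8 with ⟨h8, -⟩ | ⟨w, d, -, -, h8⟩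
      · have : lab q c = c := Hashlock.party.inj h8
        exact hG.loopless q (by rwa [← this, hlq] at hqc)
      · exact hno s le_rfl _ _ h8
    obtain ⟨g1, -, g3, -, g5, g6, -⟩ := hex p q hpq
    rw [hs₀] at g5 g6
    obtain ⟨d, hd, hd'⟩ := incoming_of_safe hG hs (hno s le_rfl)
      (contract_mono (Nat.succ_le_succ hle) h3) h1 (by omega)
      (.inr ⟨p, _, contract_mono (Nat.succ_le_of_lt g6) g3, by rw [g1, hpql, hlq], g5⟩) haq
    obtain ⟨rfl, hlt⟩ := hcr hd
    refine ⟨hlt, ?_⟩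
    rcases hd' with h | h
    · exact hlab haq h
    · exact (hlab haq h).trans hlq
  -- all contracts are created before time `s`: the arcs along which this spreads backwards from `p`
  -- are those that are foreign or leave `q`
  let F : V → V → Prop := fun x y => G.Adj x y ∧ (lab x y ≠ x ∨ x = q)
  have hspread : ∀ x, Relation.ReflTransGen F x p → ∀ a, G.Adj a x → cr a x < s ∧
      (lab a x = q ∨ Relation.ReflTransGen F (lab a x) p) := by
    intro x hx
    induction hx using Relation.ReflTransGen.head_induction_on with
    | refl =>
      intro a ha
      have hne : lab p q ≠ p := by
        rw [hpql]
        rintro rfl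
        exact hG.loopless _ hpq
      obtain ⟨-, -, -, -, -, h6, -⟩ := hex p q hpq
      rw [hs₀] at h6
      obtain ⟨h1, h2⟩ := hforeign a p q ha hpq hne h6.le
      refine ⟨h1.trans h6, ?_⟩
      rcases h2 with h2 | h2
      · rw [h2]
        exact .inr .refl
      · exact .inl (h2.trans hpql)
    | @head x y hxy hyp ih =>
      intro a ha
      obtain ⟨h1, h2⟩ := ih x hxy.1
      by_cases hne : lab x y = x
      · obtain rfl : x = q := hxy.2.resolve_left (not_not_intro hne)
        obtain ⟨h3, h4⟩ := hown y hxy.1 hne h1.le a ha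
        exact ⟨h3, .inl h4⟩
      · obtain ⟨h3, h4⟩ := hforeign a x y ha hxy.1 hne h1.le
        refine ⟨h3.trans h1, ?_⟩
        rcases h4 with h4 | h4
        · rw [h4]
          exact .inr (hyp.head hxy)
        · rw [h4]
          exact h2
  have hall : ∀ x, Relation.ReflTransGen F x p := by
    intro x
    induction hG.stronglyConnected x p using Relation.ReflTransGen.head_induction_on with
    | refl => exact .refl
    | @head x y hxy _ ih =>
      by_cases hne : lab x y = x
      · rcases (hspread y ih x hxy).2 with h | h
        · exact ih.head ⟨hxy, .inr (hne.symm.trans h)⟩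
        · rwa [hne] at h
      · exact ih.head ⟨hxy, .inl hne⟩
  have hcrs : ∀ a b, G.Adj a b → cr a b ≤ s := fun a b hab => (hspread b (hall b) a hab).1.le
  refine ⟨lab, cr, cl, fun a b c hab hbc hne => hforeign a b c hab hbc hne (hcrs b c hbc), hnext,
    p, q, hpq, hpql, ?_⟩
  rintro ⟨c, hqc, hlq⟩ a ha
  exact (hown c hqc hlq (hcrs q c hqc) a ha).2

theorem isReuniclus_of_subsingleton [Subsingleton V] [Nonempty V] (G : Digraph V) :
    IsReuniclus G := by
  obtain ⟨r⟩ := ‹Nonempty V›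
  refine ⟨Set.univ, r, id, fun _ => Set.univ, trivial, fun _ _ _ => trivial,
    fun b _ => ⟨0, Subsingleton.elim _ _⟩, fun b _ => ⟨trivial, fun x y => ?_, fun c hc => ?_⟩,
    fun x y _ => ⟨r, trivial, trivial, trivial⟩, fun x hx => (hx trivial).elim,
    fun c _ => ⟨fun _ => Subsingleton.elim _ _, fun _ => trivial⟩,
    fun b _ hb => (hb (Subsingleton.elim _ _)).elim, fun b _ hb => (hb (Subsingleton.elim _ _)).elim⟩
  · rw [Subsingleton.elim x y]
  · obtain ⟨x, hx⟩ := List.exists_mem_of_ne_nil c hc.1.1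
    rwa [Subsingleton.elim x ⟨b, trivial⟩] at hx

theorem isReuniclus_of_live_of_safe [Finite V] [Nonempty V] {G : Digraph V} (hG : IsSwapDigraph G)
    {P : Protocol V} (hl : Live G P) (hs : Safe G P) : IsReuniclus G := by
  rcases subsingleton_or_nontrivial V with _ | _
  · exact isReuniclus_of_subsingleton G
  · obtain ⟨lab, cr, cl, h⟩ := exists_isLabelling hG hl hs
    exact h.isReuniclus hG

end HTLCSwap

theorem theorem1 {V : Type*} [Finite V] [Nonempty V] (G : Digraph V)
    (hG : HTLCSwap.IsSwapDigraph G) :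
    ((∃ P : HTLCSwap.Protocol V,
        ∀ pref : ∀ D : Set V, HTLCSwap.Preference G D, HTLCSwap.IsAtomic G pref P) ↔
      HTLCSwap.IsReuniclus G) ∧
    ∀ pref : ∀ D : Set V, HTLCSwap.Preference G D,
      ((∃ P : HTLCSwap.Protocol V, HTLCSwap.IsAtomic G pref P) ↔ HTLCSwap.IsReuniclus G) := by
  have hsuff : HTLCSwap.IsReuniclus G → ∃ P : HTLCSwap.Protocol V,
      ∀ pref : ∀ D : Set V, HTLCSwap.Preference G D, HTLCSwap.IsAtomic G pref P := by
    intro h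
    obtain ⟨P, hl, hs⟩ := h.exists_live_safe hG
    exact ⟨P, fun pref => ⟨hl, hs, HTLCSwap.strongNash_of_live_of_safe hG hl hs pref⟩⟩
  have hnec : ∀ pref : ∀ D : Set V, HTLCSwap.Preference G D, ∀ P : HTLCSwap.Protocol V,
      HTLCSwap.IsAtomic G pref P → HTLCSwap.IsReuniclus G := fun pref P h =>
    HTLCSwap.isReuniclus_of_live_of_safe hG h.live h.safe
  refine ⟨⟨?_, hsuff⟩, fun pref => ⟨fun ⟨P, h⟩ => hnec pref P h, fun h => ?_⟩⟩
  · rintro ⟨P, h⟩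
    exact hnec _ P (h fun D => HTLCSwap.minimalPreference hG.stronglyConnected D)
  · obtain ⟨P, hP⟩ := hsuff h
    exact ⟨P, hP pref⟩
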